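/- Let $X$ be a (Hausdorff, finite-dimensional) complex manifold with tangent bundle $TX$, and let $A\to X$ be a holomorphic vector bundle of finite rank, with sheaf of holomorphic sections $\mathcal{A}$ and sheaf of smooth sections $\mathcal{A}_\infty\supset\mathcal{A}$. A structure of holomorphic Lie algebroid on $A\to X$ consists of a holomorphic bundle map $\rho:A\to TX$ (the anchor) and a structure of sheaf of complex Lie algebras $[\cdot,\cdot]$ on $\mathcal{A}$ such that, for every open $U\subset X$, all $V,W\in\mathcal{A}(U)$ and all holomorphic $f:U\to\mathbb{C}$, $$\rho([V,W])=[\rho(V),\rho(W)],\qquad [V,fW]=(\rho(V)f)\,W+f\,[V,W].$$ A structure of real smooth Lie algebroid on the underlying smooth real vector bundle $A\to X$ consists of a smooth real bundle map $A\to TX$ (the anchor) and a real Lie algebra bracket on the space $\Gamma(A)$ of global smooth sections satisfying the same two identities for smooth sections and smooth functions $f:X\to\mathbb{R}$; it induces, by restriction to open subsets, a structure of sheaf of real Lie algebras on $\mathcal{A}_\infty$. **Proposition.** Given a structure of holomorphic Lie algebroid on $A\to X$ with anchor $\rho$, there exists a unique structure of real smooth Lie algebroid on the vector bundle $A\to X$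 with the same anchor map $\rho$ such that the inclusion of sheaves $\mathcal{A}\subset\mathcal{A}_\infty$ is a morphism of sheaves of real Lie algebras. -/

import Mathlib

open Bundle TopologicalSpace
open scoped Manifold ContDiff Bundle

noncomputable section

/-- The derivative `v f` of a scalar function `f` along a tangent vector `v` at `x`. -/
def derivAlong {𝕜 : Type*} [NontriviallyNormedField 𝕜]
    {E : Type*} [NormedAddCommGroup E] [NormedSpace 𝕜 E]
    {M : Type*} [TopologicalSpace M] [ChartedSpace E M]
    (f : M → 𝕜) (x : M) (v : TangentSpace 𝓘(𝕜, E) x) : 𝕜 :=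
  mfderiv 𝓘(𝕜, E) 𝓘(𝕜, 𝕜) f x v

/-! ## Sheaves of sections, anchors and brackets

`𝕜` is the base field, `X` a (boundaryless) `C^n` manifold over `𝕜` modelled on `E`, and `A → X` a
`C^n` vector bundle with model fibre `F`.  For `𝕜 = ℂ` and `n = ω` this is the holomorphic category
and for `𝕜 = ℝ` and `n = ∞` the real smooth one. -/

section General

variable (𝕜 : Type*) [NontriviallyNormedField 𝕜]
  (E : Type*) [NormedAddCommGroup E] [NormedSpace 𝕜 E]
  {X : Type*} [TopologicalSpace X] [ChartedSpace E X]
  (n : ℕ∞ω)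
  (F : Type*) [NormedAddCommGroup F] [NormedSpace 𝕜 F]
  (A : X → Type*) [TopologicalSpace (TotalSpace F A)]
  [∀ x, TopologicalSpace (A x)] [FiberBundle F A]

/-- A section `s` of `A` over the open subset `U` is of class `C^n`: it is `C^n` as a map from the
open submanifold `U` to the total space of `A`. -/
def IsSectionOn (U : Opens X) (s : ∀ x : U, A x) : Prop :=
  ContMDiff 𝓘(𝕜, E) (𝓘(𝕜, E).prod 𝓘(𝕜, F)) n
    (fun x : U => (TotalSpace.mk' F (x : X) (s x) : TotalSpace F A))

variable {𝕜 E n F A} in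
/-- Being a `C^n` section can be tested in the trivializations of the bundle. -/
theorem isSectionOn_iff {U : Opens X} {s : ∀ x : U, A x} :
    IsSectionOn 𝕜 E n F A U s ↔ ∀ x₀ : U, ContMDiffAt 𝓘(𝕜, E) 𝓘(𝕜, F) n
      (fun x : U => (trivializationAt F A (x₀ : X) (TotalSpace.mk' F (x : X) (s x))).2) x₀ := by
  refine forall_congr' fun x₀ => ?_
  rw [contMDiffAt_totalSpace]
  exact and_iff_right (contMDiff_subtype_val x₀)

variable [∀ x, AddCommGroup (A x)] [∀ x, Module 𝕜 (A x)] [VectorBundle 𝕜 F A]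

variable {𝕜 E n F A} in
/-- The product of a `C^n` function and a `C^n` section over `U` is a `C^n` section. -/
theorem IsSectionOn.smul {U : Opens X} {f : U → 𝕜} {s : ∀ x : U, A x}
    (hf : ContMDiff 𝓘(𝕜, E) 𝓘(𝕜, 𝕜) n f) (hs : IsSectionOn 𝕜 E n F A U s) :
    IsSectionOn 𝕜 E n F A U (fun x => f x • s x) := by
  rw [isSectionOn_iff] at hs ⊢
  intro x₀
  refine ((hf x₀).smul (hs x₀)).congr_of_eventuallyEq ?_
  have hU : ∀ᶠ x : U in nhds x₀, (x : X) ∈ (trivializationAt F A (x₀ : X)).baseSet :=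
    continuous_subtype_val.continuousAt.eventually
      ((trivializationAt F A (x₀ : X)).open_baseSet.mem_nhds (mem_baseSet_trivializationAt F A _))
  filter_upwards [hU] with x hx
  exact ((trivializationAt F A (x₀ : X)).linear 𝕜 hx).2 _ _

variable {𝕜 E n F A} in
/-- The sum of two `C^n` sections over `U` is a `C^n` section. -/
theorem IsSectionOn.add {U : Opens X} {s t : ∀ x : U, A x}
    (hs : IsSectionOn 𝕜 E n F A U s) (ht : IsSectionOn 𝕜 E n F A U t) :
    IsSectionOn 𝕜 E n F A U (s + t) := by
  rw [isSectionOn_iff] at hs ht ⊢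
  intro x₀
  refine ((hs x₀).add (ht x₀)).congr_of_eventuallyEq ?_
  have hU : ∀ᶠ x : U in nhds x₀, (x : X) ∈ (trivializationAt F A (x₀ : X)).baseSet :=
    continuous_subtype_val.continuousAt.eventually
      ((trivializationAt F A (x₀ : X)).open_baseSet.mem_nhds (mem_baseSet_trivializationAt F A _))
  filter_upwards [hU] with x hx
  exact ((trivializationAt F A (x₀ : X)).linear 𝕜 hx).1 _ _

/-- The `𝕜`-module of `C^n` sections of `A` over the open subset `U`, i.e. the value on `U` of the
sheaf of `C^n` sections of `A`. -/
def SectionsOn (U : Opens X) : Submodule 𝕜 (∀ x : U, A x) where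
  carrier := {s | IsSectionOn 𝕜 E n F A U s}
  add_mem' hs ht := IsSectionOn.add hs ht
  zero_mem' := fun x₀ =>
    ((contMDiff_zeroSection (n := n) (IB := 𝓘(𝕜, E)) (F := F) 𝕜 A) (x₀ : X)).comp x₀
      (contMDiff_subtype_val x₀)
  smul_mem' c _ hs := IsSectionOn.smul (f := fun _ => c) contMDiff_const hs

namespace SectionsOn

variable {𝕜 E n F A}

/-- Restriction of sections to a smaller open subset. -/
def res {U V : Opens X} (h : V ≤ U) (s : SectionsOn 𝕜 E n F A U) : SectionsOn 𝕜 E n F A V :=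
  ⟨fun x => s.1 (Opens.inclusion h x), s.2.comp (contMDiff_inclusion h)⟩

/-- Multiplication of a section over `U` by a `C^n` function on `U`. -/
def fsmul {U : Opens X} (f : C^n⟮𝓘(𝕜, E), U; 𝕜⟯) (s : SectionsOn 𝕜 E n F A U) :
    SectionsOn 𝕜 E n F A U :=
  ⟨fun x => f x • s.1 x, IsSectionOn.smul f.contMDiff s.2⟩

/-- Restriction of a global section of `A` to the open subset `U`. -/
def ofGlobal (U : Opens X) (s : Cₛ^n⟮𝓘(𝕜, E); F, A⟯) : SectionsOn 𝕜 E n F A U :=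
  ⟨fun x => s x, s.contMDiff.comp contMDiff_subtype_val⟩

end SectionsOn

/-- A `C^n` bundle map `ρ : A → TX` over the identity of `X`, linear over `𝕜` on the fibres. -/
structure AnchorMap [IsManifold 𝓘(𝕜, E) 1 X] where
  /-- the linear map on each fibre -/
  toFun : ∀ x : X, A x →L[𝕜] TangentSpace 𝓘(𝕜, E) x
  /-- the map is `C^n` between the total spaces -/
  contMDiff_toFun : ContMDiff (𝓘(𝕜, E).prod 𝓘(𝕜, F)) (𝓘(𝕜, E).prod 𝓘(𝕜, E)) n
    (fun v : TotalSpace F A =>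
      (TotalSpace.mk' E v.proj (toFun v.proj v.2) : TangentBundle 𝓘(𝕜, E) X))

variable {𝕜 E n F A} in
/-- The vector field `ρ(V)` on the open submanifold `U`, for `V` a section of `A` over `U`.
(The chart of `U` at `x` is the restriction of the chart of `X` at `x`, so that the tangent spaces
of `U` and of `X` at `x` are literally the same space.) -/
def AnchorMap.onSections [IsManifold 𝓘(𝕜, E) 1 X] (ρ : AnchorMap 𝕜 E n F A)
    {U : Opens X} (V : SectionsOn 𝕜 E n F A U) : ∀ x : U, TangentSpace 𝓘(𝕜, E) x :=
  fun x => ρ.toFun (x : X) (V.1 x)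

/-- A structure of sheaf of Lie algebras over `𝕜` on the sheaf of `C^n` sections of `A`:
a Lie bracket on the sections over each open subset, compatible with restrictions. -/
structure SheafLieStructure where
  /-- the bracket of sections over `U` -/
  lie : ∀ U : Opens X,
    SectionsOn 𝕜 E n F A U →ₗ[𝕜] SectionsOn 𝕜 E n F A U →ₗ[𝕜] SectionsOn 𝕜 E n F A U
  lie_self : ∀ (U : Opens X) (V : SectionsOn 𝕜 E n F A U), lie U V V = 0
  jacobi : ∀ (U : Opens X) (V W Z : SectionsOn 𝕜 E n F A U),
    lie U V (lie U W Z) + lie U W (lie U Z V) + lie U Z (lie U V W) = 0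
  lie_res : ∀ (U U' : Opens X) (h : U' ≤ U) (V W : SectionsOn 𝕜 E n F A U),
    lie U' (SectionsOn.res h V) (SectionsOn.res h W) = SectionsOn.res h (lie U V W)

end General

/-! ## Holomorphic Lie algebroids -/

section Holomorphic

variable (E : Type*) [NormedAddCommGroup E] [NormedSpace ℂ E]
  {X : Type*} [TopologicalSpace X] [ChartedSpace E X] [IsManifold 𝓘(ℂ, E) ω X]
  (F : Type*) [NormedAddCommGroup F] [NormedSpace ℂ F]
  (A : X → Type*) [TopologicalSpace (TotalSpace F A)]
  [∀ x, TopologicalSpace (A x)] [FiberBundle F A]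
  [∀ x, AddCommGroup (A x)] [∀ x, Module ℂ (A x)] [VectorBundle ℂ F A]
  [ContMDiffVectorBundle ω F A 𝓘(ℂ, E)]

/-- A structure of holomorphic Lie algebroid on the holomorphic vector bundle `A → X`. -/
structure HolomorphicLieAlgebroid where
  /-- the anchor, a holomorphic bundle map `A → TX` -/
  anchor : AnchorMap ℂ E ω F A
  /-- the structure of sheaf of complex Lie algebras on the sheaf of holomorphic sections -/
  bracket : SheafLieStructure ℂ E ω F A
  /-- `ρ[V, W] = [ρ V, ρ W]` for holomorphic sections over any open subset -/
  anchor_lie : ∀ (U : Opens X) (V W : SectionsOn ℂ E ω F A U) (x : U),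
    anchor.onSections (bracket.lie U V W) x =
      VectorField.mlieBracket 𝓘(ℂ, E) (anchor.onSections V) (anchor.onSections W) x
  /-- `[V, f W] = (ρ(V) f) W + f [V, W]` -/
  leibniz : ∀ (U : Opens X) (f : C^ω⟮𝓘(ℂ, E), U; ℂ⟯)
    (V W : SectionsOn ℂ E ω F A U) (x : U),
    (bracket.lie U V (SectionsOn.fsmul f W)).1 x =
      derivAlong f x (anchor.onSections V x) • W.1 x +
        f x • (bracket.lie U V W).1 x

end Holomorphic

/-! ## Real smooth Lie algebroids -/

section Smooth

variable (E : Type*) [NormedAddCommGroup E] [NormedSpace ℝ E]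
  {X : Type*} [TopologicalSpace X] [ChartedSpace E X] [IsManifold 𝓘(ℝ, E) ∞ X]
  (F : Type*) [NormedAddCommGroup F] [NormedSpace ℝ F]
  (A : X → Type*) [TopologicalSpace (TotalSpace F A)]
  [∀ x, TopologicalSpace (A x)] [FiberBundle F A]
  [∀ x, AddCommGroup (A x)] [∀ x, Module ℝ (A x)] [VectorBundle ℝ F A]
  [ContMDiffVectorBundle ∞ F A 𝓘(ℝ, E)]

/-- A structure of (real, smooth) Lie algebroid on the smooth real vector bundle `A → X`: an anchor
`ρ : A → TX` and a real Lie bracket on the space of global smooth sections of `A`. -/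
structure SmoothLieAlgebroid where
  /-- the anchor, a smooth bundle map `A → TX` -/
  anchor : AnchorMap ℝ E ∞ F A
  /-- the bracket on global smooth sections -/
  lie : Cₛ^∞⟮𝓘(ℝ, E); F, A⟯ →ₗ[ℝ] Cₛ^∞⟮𝓘(ℝ, E); F, A⟯ →ₗ[ℝ] Cₛ^∞⟮𝓘(ℝ, E); F, A⟯
  lie_self : ∀ V, lie V V = 0
  jacobi : ∀ V W Z, lie V (lie W Z) + lie W (lie Z V) + lie Z (lie V W) = 0
  /-- `ρ[V, W] = [ρ V, ρ W]` -/
  anchor_lie : ∀ (V W : Cₛ^∞⟮𝓘(ℝ, E); F, A⟯) (x : X),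
    anchor.toFun x (lie V W x) =
      VectorField.mlieBracket 𝓘(ℝ, E)
        (fun y => anchor.toFun y (V y)) (fun y => anchor.toFun y (W y)) x
  /-- `[V, f W] = (ρ(V) f) W + f [V, W]` -/
  leibniz : ∀ (f : C^∞⟮𝓘(ℝ, E), X; ℝ⟯) (V W : Cₛ^∞⟮𝓘(ℝ, E); F, A⟯) (x : X),
    lie V ⟨fun y => f y • W y, f.contMDiff.smul_section W.contMDiff⟩ x =
      derivAlong f x (anchor.toFun x (V x)) • W x + f x • lie V W x

variable {E F A} in
/-- The structure `S` of sheaf of real Lie algebras on the sheaf of smooth sections of `A` is the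
one induced by the Lie algebroid `L`: restricting global sections to any open subset is compatible
with the brackets. -/
def SmoothLieAlgebroid.Induces (L : SmoothLieAlgebroid E F A)
    (S : SheafLieStructure ℝ E ∞ F A) : Prop :=
  ∀ (U : Opens X) (V W : Cₛ^∞⟮𝓘(ℝ, E); F, A⟯),
    S.lie U (SectionsOn.ofGlobal U V) (SectionsOn.ofGlobal U W) = SectionsOn.ofGlobal U (L.lie V W)

end Smooth

/-! ## Forgetting the complex structure -/

section Forget

/-- A trivialization that is complex linear on the fibres is real linear on the fibres. -/
theorem Bundle.Trivialization.IsLinear.forgetComplex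
    {X : Type*} [TopologicalSpace X] {F : Type*} [NormedAddCommGroup F] [NormedSpace ℂ F]
    {A : X → Type*} [TopologicalSpace (TotalSpace F A)]
    [∀ x, AddCommGroup (A x)] [∀ x, Module ℂ (A x)] (e : Trivialization F (π F A))
    [e.IsLinear ℂ] : e.IsLinear ℝ :=
  ⟨fun b hb => ⟨(e.linear ℂ hb).1, fun c v => by simpa using (e.linear ℂ hb).2 (c : ℂ) v⟩⟩

variable {E : Type*} [NormedAddCommGroup E] [NormedSpace ℂ E]
  {X : Type*} [TopologicalSpace X] [ChartedSpace E X]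
  {F : Type*} [NormedAddCommGroup F] [NormedSpace ℂ F]
  {A : X → Type*} [TopologicalSpace (TotalSpace F A)]
  [∀ x, TopologicalSpace (A x)] [FiberBundle F A]

/-- A holomorphic section is a smooth section. -/
theorem IsSectionOn.forgetComplex {U : Opens X} {s : ∀ x : U, A x}
    (hs : IsSectionOn ℂ E ω F A U s) : IsSectionOn ℝ E ∞ F A U s := by
  refine ContMDiff.of_le (n := ω) (fun x => ?_) le_top
  have h := hs x
  rw [contMDiffAt_iff] at h ⊢
  exact ⟨h.1, h.2.restrict_scalars ℝ⟩

variable [∀ x, AddCommGroup (A x)] [∀ x, Module ℂ (A x)]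

/-- A complex manifold is a real manifold. -/
instance IsManifold.forgetComplex (n : ℕ∞ω) [h : IsManifold 𝓘(ℂ, E) n X] :
    IsManifold 𝓘(ℝ, E) n X := by
  refine isManifold_of_contDiffOn 𝓘(ℝ, E) n X fun e e' he he' => ?_
  have h1 := (contDiffGroupoid n 𝓘(ℂ, E)).compatible he he'
  rw [contDiffGroupoid, mem_groupoid_of_pregroupoid] at h1
  exact h1.1.restrict_scalars ℝ

/-- A complex vector bundle is a real vector bundle. -/
instance VectorBundle.forgetComplex [VectorBundle ℂ F A] : VectorBundle ℝ F A where
  trivialization_linear' e _ := Bundle.Trivialization.IsLinear.forgetComplex e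
  continuousOn_coordChange' e e' _ _ := by
    have := Bundle.Trivialization.IsLinear.forgetComplex e
    have := Bundle.Trivialization.IsLinear.forgetComplex e'
    have h := (ContinuousLinearMap.restrictScalarsL ℂ F F ℝ ℝ).continuous.comp_continuousOn
      (continuousOn_coordChange ℂ e e')
    refine h.congr fun b hb => ?_
    ext v
    change e.coordChangeL ℝ e' b v = e.coordChangeL ℂ e' b v
    rw [e.coordChangeL_apply e' hb, e.coordChangeL_apply e' hb]

/-- A holomorphic vector bundle is a smooth real vector bundle. -/
instance ContMDiffVectorBundle.forgetComplex [VectorBundle ℂ F A] (n : ℕ∞ω)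
    [ContMDiffVectorBundle n F A 𝓘(ℂ, E)] : ContMDiffVectorBundle n F A 𝓘(ℝ, E) where
  contMDiffOn_coordChangeL e e' _ _ := by
    have h := ContMDiffVectorBundle.contMDiffOn_coordChangeL (n := n) (IB := 𝓘(ℂ, E))
      (𝕜 := ℂ) e e'
    have h' : ContMDiffOn 𝓘(ℝ, E) 𝓘(ℝ, F →L[ℂ] F) n
        (fun b => (e.coordChangeL ℂ e' b : F →L[ℂ] F)) (e.baseSet ∩ e'.baseSet) := by
      intro x hx
      have hx' := h x hx
      rw [contMDiffWithinAt_iff] at hx' ⊢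
      exact ⟨hx'.1, hx'.2.restrict_scalars ℝ⟩
    refine ((ContinuousLinearMap.restrictScalarsL ℂ F F ℝ ℝ).contMDiff.comp_contMDiffOn h').congr
      fun b hb => ?_
    ext v
    change e.coordChangeL ℝ e' b v = e.coordChangeL ℂ e' b v
    rw [e.coordChangeL_apply e' hb, e.coordChangeL_apply e' hb]

variable [VectorBundle ℂ F A]

variable (E F A) in
/-- The inclusion over `U` of the sheaf of holomorphic sections of `A` into the sheaf of smooth
sections of the underlying real vector bundle. -/
def holomorphicToSmooth (U : Opens X) :
    SectionsOn ℂ E ω F A U →ₗ[ℝ] SectionsOn ℝ E ∞ F A U where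
  toFun s := ⟨s.1, IsSectionOn.forgetComplex s.2⟩
  map_add' _ _ := rfl
  map_smul' _ _ := rfl

variable (E) in
/-- The canonical identification of the tangent space at `x` of the complex manifold `X` with the
tangent space of the underlying real manifold: in the preferred chart at `x`, it is the identity
of the model space `E`. -/
def toRealTangent (x : X) : TangentSpace 𝓘(ℂ, E) x → TangentSpace 𝓘(ℝ, E) x :=
  fun v => (v : E)

end Forget

/-! In a holomorphic trivialization a section is an `F`-valued function, and a bracket obeying the
Leibniz rule is forced to be [V, W] = B(V, W) + dW(ρV) - dV(ρW), where B(u, v) is the bracket of the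
constant sections u and v. Constant sections are holomorphic, so B is known from the holomorphic
structure, and the right-hand side makes sense for smooth V and W once d is read as the real
derivative.

Existence takes this formula as the definition. For holomorphic sections it gives back the original
bracket (`lie_eq_trivBracket`), because the real derivative of a holomorphic map is its complex
derivative. Applied to the constant sections of a second trivialization, this fact is the
transformation law of B, so the formula does not depend on the trivialization (`trivBracket_eq`).
Compatibility with the anchor and the Jacobi identity become calculus statements in a chart
(`localBracket_anchor`, `localBracket_jacobi`). Their hypotheses concern B and ρ only, and are the
corresponding holomorphic axioms evaluated on constant sections.

Uniqueness: a bracket that induces a sheaf bracket is local. Bump functions turn constant sections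
into global smooth sections without changing them near a given point, and every smooth section is
there a combination of these with real smooth coefficients. By the Leibniz rule the bracket is then
determined by the anchor and by the brackets of constant sections, which the holomorphic structure
prescribes (`lie_eq_of_frame`, `lie_eq_lie`). -/

set_option linter.unusedSectionVars false

/-! ### Tangent vectors and Lie brackets on open submanifolds and in charts. -/

section Manifold

variable {𝕜 : Type*} [NontriviallyNormedField 𝕜]
  {E : Type*} [NormedAddCommGroup E] [NormedSpace 𝕜 E]
  {X : Type*} [TopologicalSpace X] [ChartedSpace E X]
  {F : Type*} [NormedAddCommGroup F] [NormedSpace 𝕜 F]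

/-- The derivative of the inclusion of an open submanifold is the identity. -/
theorem hasMFDerivAt_subtype_val (U : Opens X) (x : U) :
    HasMFDerivAt 𝓘(𝕜, E) 𝓘(𝕜, E) (Subtype.val : U → X) x (ContinuousLinearMap.id 𝕜 E) := by
  refine ⟨continuous_subtype_val.continuousAt, ?_⟩
  -- The charts of `U` are restrictions of those of `X`, so the inclusion read in charts is the
  -- identity near the point.
  have h : writtenInExtChartAt 𝓘(𝕜, E) 𝓘(𝕜, E) x (Subtype.val : U → X) =ᶠ[nhds
      (extChartAt 𝓘(𝕜, E) x x)] id := by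
    have h1 := U.chartAt_subtype_val_symm_eventuallyEq (H := E) (x := x)
    have h2 : (chartAt E x.1).target ∈ nhds (chartAt E x.1 x.1) :=
      (chartAt E x.1).open_target.mem_nhds (mem_chart_target E x.1)
    filter_upwards [h1, h2] with z hz hz2
    change chartAt E x.1 (((chartAt E x).symm z : U) : X) = z
    have : (((chartAt E x).symm z : U) : X) = (chartAt E x.1).symm z := hz.symm
    rw [this, (chartAt E x.1).right_inv hz2]
  have h' : HasFDerivAt (𝕜 := 𝕜) (writtenInExtChartAt 𝓘(𝕜, E) 𝓘(𝕜, E) x (Subtype.val : U → X))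
      (ContinuousLinearMap.id 𝕜 E) (extChartAt 𝓘(𝕜, E) x x) :=
    (hasFDerivAt_id _).congr_of_eventuallyEq h
  exact h'.hasFDerivWithinAt

theorem mfderiv_comp_subtype_val {U : Opens X} {x : U} {f : X → F}
    (hf : MDifferentiableAt 𝓘(𝕜, E) 𝓘(𝕜, F) f x) (v : E) :
    mfderiv 𝓘(𝕜, E) 𝓘(𝕜, F) (fun y : U => f y) x v = mfderiv 𝓘(𝕜, E) 𝓘(𝕜, F) f (x : X) v := by
  have := (hf.hasMFDerivAt.comp x (hasMFDerivAt_subtype_val U x)).mfderiv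
  exact congrArg (fun T : E →L[𝕜] F => T v) this

/-- The Lie bracket of vector fields is compatible with restriction to open submanifolds. -/
theorem mlieBracket_subtype [CompleteSpace E] [IsManifold 𝓘(𝕜, E) ω X]
    {U : Opens X} {x : U} {V W : ∀ y : X, TangentSpace 𝓘(𝕜, E) y}
    (hV : MDifferentiableAt 𝓘(𝕜, E) 𝓘(𝕜, E).tangent
      (fun y => (⟨y, V y⟩ : TangentBundle 𝓘(𝕜, E) X)) x)
    (hW : MDifferentiableAt 𝓘(𝕜, E) 𝓘(𝕜, E).tangent
      (fun y => (⟨y, W y⟩ : TangentBundle 𝓘(𝕜, E) X)) x) :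
    VectorField.mlieBracket 𝓘(𝕜, E) (M := U) (fun y => V y) (fun y => W y) x =
      VectorField.mlieBracket 𝓘(𝕜, E) V W x := by
  have : IsManifold 𝓘(𝕜, E) (minSmoothness 𝕜 3) X :=
    IsManifold.of_le (n := ω) le_top
  -- Brackets commute with pullback, and pulling back along the inclusion changes nothing since its
  -- derivative is the identity.
  have h := VectorField.mpullback_mlieBracket (f := (Subtype.val : U → X)) (x₀ := x) hV hW
    (contMDiff_subtype_val (n := ω) x) le_top
  have key : ∀ (V : ∀ y : X, TangentSpace 𝓘(𝕜, E) y) (y : U),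
      VectorField.mpullback 𝓘(𝕜, E) 𝓘(𝕜, E) (Subtype.val : U → X) V y = V y := by
    intro V y
    rw [VectorField.mpullback_apply, (hasMFDerivAt_subtype_val U y).mfderiv]
    exact congrArg (fun T : E →L[𝕜] E => T (V y)) ContinuousLinearMap.inverse_id
  rw [key] at h
  rw [h]
  congr 1 <;> funext y <;> exact (key _ y).symm

variable (𝕜) in
/-- The expression of a vector field in the chart at `x`. -/
def fieldCoord (x : X) (V : ∀ y : X, TangentSpace 𝓘(𝕜, E) y) (z : E) : E :=
  mfderiv 𝓘(𝕜, E) 𝓘(𝕜, E) (extChartAt 𝓘(𝕜, E) x) ((extChartAt 𝓘(𝕜, E) x).symm z)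
    (V ((extChartAt 𝓘(𝕜, E) x).symm z))

/-- The manifold bracket is the vector space bracket transported by the chart. Taking the chart at
the evaluation point itself, where its derivative is the identity, removes the transport of the
result. -/
theorem mlieBracket_eq_lieBracket_fieldCoord [IsManifold 𝓘(𝕜, E) 1 X]
    (V W : ∀ y : X, TangentSpace 𝓘(𝕜, E) y) (x : X) :
    VectorField.mlieBracket 𝓘(𝕜, E) V W x =
      VectorField.lieBracket 𝕜 (fieldCoord 𝕜 x V) (fieldCoord 𝕜 x W)
        (extChartAt 𝓘(𝕜, E) x x) := by
  have key : ∀ V : ∀ y : X, TangentSpace 𝓘(𝕜, E) y,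
      VectorField.mpullbackWithin 𝓘(𝕜, E) 𝓘(𝕜, E) (extChartAt 𝓘(𝕜, E) x).symm V
        (Set.range 𝓘(𝕜, E)) =ᶠ[nhds (extChartAt 𝓘(𝕜, E) x x)] fieldCoord 𝕜 x V := by
    intro V
    filter_upwards [extChartAt_target_mem_nhds (I := 𝓘(𝕜, E)) x] with z hz
    rw [VectorField.mpullbackWithin_apply, fieldCoord]
    rw [ContinuousLinearMap.inverse_eq
      (mfderivWithin_extChartAt_symm_comp_mfderiv_extChartAt hz)
      (mfderiv_extChartAt_comp_mfderivWithin_extChartAt_symm hz)]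
    rfl
  rw [← VectorField.mlieBracketWithin_univ, VectorField.mlieBracketWithin_apply,
    mfderiv_extChartAt_self]
  simp only [Set.preimage_univ, Set.univ_inter, modelWithCornersSelf_coe, Set.range_id]
  have h := Filter.EventuallyEq.lieBracket_vectorField_eq (𝕜 := 𝕜) (key V) (key W)
  simp only [modelWithCornersSelf_coe, Set.range_id] at h
  refine (congrArg (fun T : E →L[𝕜] E => T _) ContinuousLinearMap.inverse_id).trans ?_
  exact (congrFun VectorField.lieBracketWithin_univ _).trans h

/-- The chain rule computing the derivative of `f` in the chart at `x`. -/
theorem mfderiv_eq_fderiv_comp_extChartAt_symm [IsManifold 𝓘(𝕜, E) 1 X] {f : X → F} {x y : X}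
    (hy : y ∈ (chartAt E x).source) (hf : MDifferentiableAt 𝓘(𝕜, E) 𝓘(𝕜, F) f y) (v : E) :
    mfderiv 𝓘(𝕜, E) 𝓘(𝕜, F) f y v =
      fderiv 𝕜 (f ∘ (extChartAt 𝓘(𝕜, E) x).symm) (extChartAt 𝓘(𝕜, E) x y)
        (mfderiv 𝓘(𝕜, E) 𝓘(𝕜, E) (extChartAt 𝓘(𝕜, E) x) y v) := by
  have hy' : y ∈ (extChartAt 𝓘(𝕜, E) x).source := by simpa using hy
  have h1 := hasMFDerivAt_extChartAt (I := 𝓘(𝕜, E)) hy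
  have hs : MDifferentiableAt 𝓘(𝕜, E) 𝓘(𝕜, E) (extChartAt 𝓘(𝕜, E) x).symm
      (extChartAt 𝓘(𝕜, E) x y) := by
    have := mdifferentiableWithinAt_extChartAt_symm (I := 𝓘(𝕜, E))
      ((extChartAt 𝓘(𝕜, E) x).map_source hy')
    simpa [mdifferentiableWithinAt_univ] using this
  have h2 : MDifferentiableAt 𝓘(𝕜, E) 𝓘(𝕜, F) (f ∘ (extChartAt 𝓘(𝕜, E) x).symm)
      (extChartAt 𝓘(𝕜, E) x y) := by
    refine MDifferentiableAt.comp (I' := 𝓘(𝕜, E)) _ ?_ hs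
    rwa [(extChartAt 𝓘(𝕜, E) x).left_inv hy']
  have h3 := (h2.hasMFDerivAt.comp y h1)
  have h4 : f =ᶠ[nhds y] (f ∘ (extChartAt 𝓘(𝕜, E) x).symm) ∘ extChartAt 𝓘(𝕜, E) x := by
    filter_upwards [(isOpen_extChartAt_source x).mem_nhds hy'] with w hw
    simp only [Function.comp_apply]
    rw [(extChartAt 𝓘(𝕜, E) x).left_inv hw]
  rw [(h3.congr_of_eventuallyEq h4).mfderiv, mfderiv_eq_fderiv, h1.mfderiv]
  rfl

/-- A function is `C^n` at `y` if and only if it is so in a chart around `y`. -/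
theorem ContMDiffAt.contDiffAt_comp_extChartAt_symm {n : ℕ∞ω} [IsManifold 𝓘(𝕜, E) n X]
    {f : X → F} {x y : X} (hy : y ∈ (chartAt E x).source)
    (hf : ContMDiffAt 𝓘(𝕜, E) 𝓘(𝕜, F) n f y) :
    ContDiffAt 𝕜 n (f ∘ (extChartAt 𝓘(𝕜, E) x).symm) (extChartAt 𝓘(𝕜, E) x y) := by
  have hy' : y ∈ (extChartAt 𝓘(𝕜, E) x).source := by simpa using hy
  have h1 : ContMDiffAt 𝓘(𝕜, E) 𝓘(𝕜, E) n (extChartAt 𝓘(𝕜, E) x).symm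
      (extChartAt 𝓘(𝕜, E) x y) :=
    (contMDiffOn_extChartAt_symm x).contMDiffAt
      ((isOpen_extChartAt_target x).mem_nhds ((extChartAt 𝓘(𝕜, E) x).map_source hy'))
  refine ContMDiffAt.contDiffAt (ContMDiffAt.comp (I' := 𝓘(𝕜, E)) _ ?_ h1)
  rwa [(extChartAt 𝓘(𝕜, E) x).left_inv hy']

/-- The preferred trivialization of the tangent bundle is the derivative of the chart. -/
theorem trivializationAt_tangentSpace_snd [IsManifold 𝓘(𝕜, E) 1 X] {x y : X}
    (hy : y ∈ (chartAt E x).source) (v : TangentSpace 𝓘(𝕜, E) y) :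
    (trivializationAt E (TangentSpace 𝓘(𝕜, E)) x ⟨y, v⟩).2 =
      (mfderiv 𝓘(𝕜, E) 𝓘(𝕜, E) (extChartAt 𝓘(𝕜, E) x) y v : E) := by
  have h := TangentBundle.continuousLinearMapAt_trivializationAt (I := 𝓘(𝕜, E)) hy
  refine Eq.trans ?_ (congrArg (fun T : TangentSpace 𝓘(𝕜, E) y →L[𝕜] E => T v) h)
  rw [Trivialization.continuousLinearMapAt_apply, Trivialization.linearMapAt_apply, if_pos]
  simpa using hy

/-- A `C^n` vector field has a `C^n` expression in a chart. -/
theorem contDiffAt_fieldCoord [IsManifold 𝓘(𝕜, E) ω X] {n : ℕ∞ω} {x y : X}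
    (hy : y ∈ (chartAt E x).source)
    [IsManifold 𝓘(𝕜, E) 1 X]
    {V : ∀ y : X, TangentSpace 𝓘(𝕜, E) y} (hV : ContMDiffAt 𝓘(𝕜, E) 𝓘(𝕜, E).tangent n
      (fun y => (⟨y, V y⟩ : TangentBundle 𝓘(𝕜, E) X)) y) :
    ContDiffAt 𝕜 n (fieldCoord 𝕜 x V) (extChartAt 𝓘(𝕜, E) x y) := by
  have : IsManifold 𝓘(𝕜, E) (n + 1) X := IsManifold.of_le (n := ω) le_top
  have : IsManifold 𝓘(𝕜, E) n X := IsManifold.of_le (n := ω) le_top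
  have hy' : y ∈ (trivializationAt E (TangentSpace 𝓘(𝕜, E)) x).baseSet := by
    simpa using hy
  have h := ((trivializationAt E (TangentSpace 𝓘(𝕜, E)) x).contMDiffAt_section_iff hy').1 hV
  refine (h.contDiffAt_comp_extChartAt_symm hy).congr_of_eventuallyEq ?_
  filter_upwards [(isOpen_extChartAt_target (I := 𝓘(𝕜, E)) x).mem_nhds
    ((extChartAt 𝓘(𝕜, E) x).map_source (by simpa using hy))] with z hz
  have hz' : (extChartAt 𝓘(𝕜, E) x).symm z ∈ (chartAt E x).source := by
    simpa using (extChartAt 𝓘(𝕜, E) x).map_target hz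
  exact (trivializationAt_tangentSpace_snd hz' _).symm

end Manifold

/-! ### Real and complex derivatives of holomorphic objects. -/

section Forget

variable {E : Type*} [NormedAddCommGroup E] [NormedSpace ℂ E]
  {X : Type*} [TopologicalSpace X] [ChartedSpace E X]
  {F : Type*} [NormedAddCommGroup F] [NormedSpace ℂ F]

theorem MDifferentiableAt.forgetComplex {f : X → F} {x : X}
    (hf : MDifferentiableAt 𝓘(ℂ, E) 𝓘(ℂ, F) f x) : MDifferentiableAt 𝓘(ℝ, E) 𝓘(ℝ, F) f x := by
  rw [mdifferentiableAt_iff] at hf ⊢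
  exact ⟨hf.1, hf.2.restrictScalars ℝ⟩

theorem ContMDiffAt.forgetComplex {n : ℕ∞ω} {f : X → F} {x : X}
    (hf : ContMDiffAt 𝓘(ℂ, E) 𝓘(ℂ, F) n f x) : ContMDiffAt 𝓘(ℝ, E) 𝓘(ℝ, F) n f x := by
  rw [contMDiffAt_iff] at hf ⊢
  exact ⟨hf.1, hf.2.restrict_scalars ℝ⟩

/-- The real derivative of a holomorphic map is its complex derivative. -/
theorem mfderiv_forgetComplex {f : X → F} {x : X}
    (hf : MDifferentiableAt 𝓘(ℂ, E) 𝓘(ℂ, F) f x) (v : E) :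
    mfderiv 𝓘(ℝ, E) 𝓘(ℝ, F) f x v = mfderiv 𝓘(ℂ, E) 𝓘(ℂ, F) f x v := by
  let T : E →L[ℂ] F := mfderiv 𝓘(ℂ, E) 𝓘(ℂ, F) f x
  have h0 : HasMFDerivAt 𝓘(ℂ, E) 𝓘(ℂ, F) f x T := hf.hasMFDerivAt
  have h : HasMFDerivAt 𝓘(ℝ, E) 𝓘(ℝ, F) f x (T.restrictScalars ℝ) :=
    ⟨h0.1, HasFDerivWithinAt.restrictScalars ℝ h0.2⟩
  exact congrArg (fun T : E →L[ℝ] F => T v) h.mfderiv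

theorem fieldCoord_forgetComplex [IsManifold 𝓘(ℂ, E) 1 X] {x : X}
    (V : ∀ y : X, TangentSpace 𝓘(ℂ, E) y) {z : E} (hz : z ∈ (extChartAt 𝓘(ℂ, E) x).target) :
    fieldCoord ℝ x (fun y => toRealTangent E y (V y)) z = fieldCoord ℂ x V z := by
  refine mfderiv_forgetComplex (mdifferentiableAt_extChartAt ?_) _
  simpa using (extChartAt 𝓘(ℂ, E) x).map_target hz

/-- The real Lie bracket of holomorphic vector fields is their complex Lie bracket. -/
theorem mlieBracket_forgetComplex [IsManifold 𝓘(ℂ, E) ω X] [IsManifold 𝓘(ℂ, E) 1 X]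
    {V W : ∀ y : X, TangentSpace 𝓘(ℂ, E) y} {x : X}
    (hV : ContMDiffAt 𝓘(ℂ, E) 𝓘(ℂ, E).tangent ω
      (fun y => (⟨y, V y⟩ : TangentBundle 𝓘(ℂ, E) X)) x)
    (hW : ContMDiffAt 𝓘(ℂ, E) 𝓘(ℂ, E).tangent ω
      (fun y => (⟨y, W y⟩ : TangentBundle 𝓘(ℂ, E) X)) x) :
    VectorField.mlieBracket 𝓘(ℝ, E) (fun y => toRealTangent E y (V y))
        (fun y => toRealTangent E y (W y)) x =
      toRealTangent E x (VectorField.mlieBracket 𝓘(ℂ, E) V W x) := by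
  have key : ∀ V : ∀ y : X, TangentSpace 𝓘(ℂ, E) y,
      fieldCoord ℝ x (fun y => toRealTangent E y (V y)) =ᶠ[nhds (extChartAt 𝓘(ℂ, E) x x)]
        fieldCoord ℂ x V := fun V => by
    filter_upwards [extChartAt_target_mem_nhds (I := 𝓘(ℂ, E)) x] with z hz
    exact fieldCoord_forgetComplex V hz
  have hV' := (contDiffAt_fieldCoord (mem_chart_source E x) hV).differentiableAt (by simp)
  have hW' := (contDiffAt_fieldCoord (mem_chart_source E x) hW).differentiableAt (by simp)
  rw [mlieBracket_eq_lieBracket_fieldCoord, toRealTangent, mlieBracket_eq_lieBracket_fieldCoord]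
  refine ((key V).lieBracket_vectorField_eq (key W)).trans ?_
  simp only [VectorField.lieBracket]
  rw [hV'.fderiv_restrictScalars ℝ, hW'.fderiv_restrictScalars ℝ]
  rfl

variable {A : X → Type*} [TopologicalSpace (TotalSpace F A)]
  [∀ x, TopologicalSpace (A x)] [FiberBundle F A]
  [∀ x, AddCommGroup (A x)] [∀ x, Module ℂ (A x)]

omit [∀ x, AddCommGroup (A x)] [∀ x, Module ℂ (A x)] in
theorem contMDiffAt_totalSpace_forgetComplex {G : Type*} [NormedAddCommGroup G] [NormedSpace ℂ G]
    {n : ℕ∞ω} {g : TotalSpace F A → G} {v : TotalSpace F A}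
    (hg : ContMDiffAt (𝓘(ℂ, E).prod 𝓘(ℂ, F)) 𝓘(ℂ, G) n g v) :
    ContMDiffAt (𝓘(ℝ, E).prod 𝓘(ℝ, F)) 𝓘(ℝ, G) n g v := by
  rw [contMDiffAt_iff] at hg ⊢
  exact ⟨hg.1, hg.2.restrict_scalars ℝ⟩

/-- The real anchor map underlying a holomorphic one. -/
def AnchorMap.forgetComplex [IsManifold 𝓘(ℂ, E) ω X] [IsManifold 𝓘(ℂ, E) 1 X]
    [IsManifold 𝓘(ℝ, E) 1 X]
    (ρ : AnchorMap ℂ E ω F A) : AnchorMap ℝ E ∞ F A where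
  toFun x :=
    { toFun := fun a => toRealTangent E x (ρ.toFun x a)
      map_add' := fun a b => (ρ.toFun x).map_add a b
      map_smul' := fun c a => by
        have h := (ρ.toFun x).map_smul (c : ℂ) a
        rw [Complex.coe_smul] at h
        refine h.trans ?_
        exact Complex.coe_smul (E := E) c (ρ.toFun x a)
      cont := (ρ.toFun x).continuous }
  contMDiff_toFun := by
    intro v
    have h := ρ.contMDiff_toFun v
    have : IsManifold 𝓘(ℝ, E) ω X := IsManifold.forgetComplex ω
    rw [contMDiffAt_totalSpace] at h ⊢
    have h2 := contMDiffAt_totalSpace_forgetComplex (v := v) (g := fun v : TotalSpace F A =>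
      ((trivializationAt E (TangentSpace 𝓘(ℂ, E)) _
        (TotalSpace.mk' E v.proj (ρ.toFun v.proj v.2))).2 : E)) h.2
    refine ⟨contMDiff_proj A v, (h2.of_le le_top).congr_of_eventuallyEq ?_⟩
    have hU : ∀ᶠ w : TotalSpace F A in nhds v, w.proj ∈ (chartAt E v.proj).source :=
      (FiberBundle.continuous_proj F A).continuousAt.eventually
        ((chartAt E v.proj).open_source.mem_nhds (mem_chart_source E v.proj))
    filter_upwards [hU] with w hw
    -- The real and complex trivializations of the tangent bundle are both given by the derivative
    -- of the chart, and the chart is holomorphic.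
    refine (trivializationAt_tangentSpace_snd hw _).trans ?_
    refine Eq.trans ?_ (trivializationAt_tangentSpace_snd hw _).symm
    exact mfderiv_forgetComplex (mdifferentiableAt_extChartAt hw) _

end Forget

/-! ### The bracket formula on a vector space. -/

section LocalBracket

variable {E : Type*} [NormedAddCommGroup E] [NormedSpace ℝ E]
  {F : Type*} [NormedAddCommGroup F] [NormedSpace ℝ F]

/-- The expression in a trivialization of the bracket of a Lie algebroid with anchor `ρ` and
structure functions `B`. -/
def localBracket (ρ : E → F →L[ℝ] E) (B : E → F →L[ℝ] F →L[ℝ] F) (V W : E → F) (z : E) : F :=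
  B z (V z) (W z) + fderiv ℝ W z (ρ z (V z)) - fderiv ℝ V z (ρ z (W z))

variable {ρ : E → F →L[ℝ] E} {B : E → F →L[ℝ] F →L[ℝ] F} {V W Z : E → F} {z : E}

/-- The product rule splits the bracket of ρV and ρW into terms differentiating V or W, which match
directly, and terms differentiating ρ, which `hρB` supplies with the values of V and W frozen at
`z`. -/
theorem localBracket_anchor (hρ : DifferentiableAt ℝ ρ z)
    (hV : DifferentiableAt ℝ V z) (hW : DifferentiableAt ℝ W z)
    (hρB : ∀ u v, ρ z (B z u v) =
      fderiv ℝ (fun y => ρ y v) z (ρ z u) - fderiv ℝ (fun y => ρ y u) z (ρ z v)) :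
    ρ z (localBracket ρ B V W z) =
      VectorField.lieBracket ℝ (fun y => ρ y (V y)) (fun y => ρ y (W y)) z := by
  have h1 : ∀ u v : F, fderiv ℝ (fun y => ρ y u) z (ρ z v) = fderiv ℝ ρ z (ρ z v) u := fun u v => by
    rw [fderiv_clm_apply hρ (differentiableAt_const u)]; simp
  simp only [VectorField.lieBracket, localBracket, map_add, map_sub, hρB, h1]
  rw [fderiv_clm_apply hρ hV, fderiv_clm_apply hρ hW]
  simp only [add_apply, ContinuousLinearMap.comp_apply,
    ContinuousLinearMap.flip_apply]
  abel

theorem fderiv_localBracket (hρ : DifferentiableAt ℝ ρ z) (hB : DifferentiableAt ℝ B z)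
    (hV : ContDiffAt ℝ 2 V z) (hW : ContDiffAt ℝ 2 W z) (v : E) :
    fderiv ℝ (localBracket ρ B V W) z v =
      fderiv ℝ B z v (V z) (W z) + B z (fderiv ℝ V z v) (W z) + B z (V z) (fderiv ℝ W z v) +
      (fderiv ℝ (fderiv ℝ W) z v (ρ z (V z)) + fderiv ℝ W z (fderiv ℝ ρ z v (V z)) +
        fderiv ℝ W z (ρ z (fderiv ℝ V z v))) -
      (fderiv ℝ (fderiv ℝ V) z v (ρ z (W z)) + fderiv ℝ V z (fderiv ℝ ρ z v (W z)) +
        fderiv ℝ V z (ρ z (fderiv ℝ W z v))) := by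
  have hV1 := hV.differentiableAt (by simp)
  have hW1 := hW.differentiableAt (by simp)
  have hV2 : DifferentiableAt ℝ (fderiv ℝ V) z :=
    (hV.fderiv_right (m := 1) (by norm_num)).differentiableAt (by simp)
  have hW2 : DifferentiableAt ℝ (fderiv ℝ W) z :=
    (hW.fderiv_right (m := 1) (by norm_num)).differentiableAt (by simp)
  have e1 := (hB.hasFDerivAt.clm_apply hV1.hasFDerivAt).clm_apply hW1.hasFDerivAt
  have e2 := hW2.hasFDerivAt.clm_apply (hρ.hasFDerivAt.clm_apply hV1.hasFDerivAt)
  have e3 := hV2.hasFDerivAt.clm_apply (hρ.hasFDerivAt.clm_apply hW1.hasFDerivAt)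
  have := ((e1.add e2).sub e3).fderiv
  change fderiv ℝ (localBracket ρ B V W) z = _ at this
  rw [this]
  simp only [add_apply, ContinuousLinearMap.comp_apply,
    ContinuousLinearMap.flip_apply, sub_apply, map_add]
  abel

set_option synthInstance.maxHeartbeats 200000 in
-- In the cyclic sum, second derivatives cancel by symmetry. Terms differentiating a section inside
-- B cancel by antisymmetry, and terms applying the derivative of a section to dρ or to ρB cancel by
-- `hρB`. What remains is `hJ` at the frozen values of the sections.
theorem localBracket_jacobi (hρ : DifferentiableAt ℝ ρ z) (hB : DifferentiableAt ℝ B z)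
    (hV : ContDiffAt ℝ 2 V z) (hW : ContDiffAt ℝ 2 W z) (hZ : ContDiffAt ℝ 2 Z z)
    (hanti : ∀ u v, B z u v = - B z v u)
    (hρB : ∀ u v, ρ z (B z u v) =
      fderiv ℝ (fun y => ρ y v) z (ρ z u) - fderiv ℝ (fun y => ρ y u) z (ρ z v))
    (hJ : ∀ u v w, (B z u (B z v w) + fderiv ℝ (fun y => B y v w) z (ρ z u)) +
      (B z v (B z w u) + fderiv ℝ (fun y => B y w u) z (ρ z v)) +
      (B z w (B z u v) + fderiv ℝ (fun y => B y u v) z (ρ z w)) = 0) :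
    localBracket ρ B V (localBracket ρ B W Z) z + localBracket ρ B W (localBracket ρ B Z V) z +
      localBracket ρ B Z (localBracket ρ B V W) z = 0 := by
  have h1 : ∀ u v, fderiv ℝ (fun y => ρ y u) z v = fderiv ℝ ρ z v u := fun u v => by
    rw [fderiv_clm_apply hρ (differentiableAt_const u)]; simp
  have h2 : ∀ u v w, fderiv ℝ (fun y => B y u v) z w = fderiv ℝ B z w u v := fun u v w => by
    rw [fderiv_clm_apply (hB.clm_apply (differentiableAt_const u)) (differentiableAt_const v),
      fderiv_clm_apply hB (differentiableAt_const u)]; simp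
  have sV : ∀ u v, fderiv ℝ (fderiv ℝ V) z u v = fderiv ℝ (fderiv ℝ V) z v u := fun u v =>
    (hV.isSymmSndFDerivAt (by simp)).eq u v
  have sW : ∀ u v, fderiv ℝ (fderiv ℝ W) z u v = fderiv ℝ (fderiv ℝ W) z v u := fun u v =>
    (hW.isSymmSndFDerivAt (by simp)).eq u v
  have sZ : ∀ u v, fderiv ℝ (fderiv ℝ Z) z u v = fderiv ℝ (fderiv ℝ Z) z v u := fun u v =>
    (hZ.isSymmSndFDerivAt (by simp)).eq u v
  have e : ∀ V W Z : E → F, localBracket ρ B V (localBracket ρ B W Z) z =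
      B z (V z) (localBracket ρ B W Z z) + fderiv ℝ (localBracket ρ B W Z) z (ρ z (V z)) -
        fderiv ℝ V z (ρ z (localBracket ρ B W Z z)) := fun _ _ _ => rfl
  have ev : ∀ V W : E → F, localBracket ρ B V W z =
    B z (V z) (W z) + fderiv ℝ W z (ρ z (V z)) - fderiv ℝ V z (ρ z (W z)) := fun _ _ => rfl
  simp only [e, fderiv_localBracket hρ hB hV hW, fderiv_localBracket hρ hB hW hZ,
    fderiv_localBracket hρ hB hZ hV]
  simp only [ev, map_add, map_sub, hρB, h1]
  have hJ' := hJ (V z) (W z) (Z z)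
  simp only [h2] at hJ'
  -- Matching terms are brought to one order of arguments, so that the cancellation becomes a matter
  -- of commutative group arithmetic.
  rw [sV (ρ z (W z)) (ρ z (Z z)), sW (ρ z (Z z)) (ρ z (V z)), sZ (ρ z (V z)) (ρ z (W z)),
    hanti (V z) (fderiv ℝ W z (ρ z (Z z))), hanti (V z) (fderiv ℝ Z z (ρ z (W z))),
    hanti (W z) (fderiv ℝ V z (ρ z (Z z))), hanti (W z) (fderiv ℝ Z z (ρ z (V z))),
    hanti (Z z) (fderiv ℝ V z (ρ z (W z))), hanti (Z z) (fderiv ℝ W z (ρ z (V z)))]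
  rw [← hJ']
  abel

end LocalBracket

/-! ### Extension of sections by zero. -/

section Extension

open Classical in
/-- Extension by zero of a section over an open subset. -/
def extendSection {X : Type*} [TopologicalSpace X] {A : X → Type*} [∀ x, AddCommGroup (A x)]
    {U : Opens X} (s : ∀ x : U, A x) (y : X) : A y :=
  if h : y ∈ U then s ⟨y, h⟩ else 0

theorem extendSection_apply {X : Type*} [TopologicalSpace X] {A : X → Type*}
    [∀ x, AddCommGroup (A x)] {U : Opens X} (s : ∀ x : U, A x) (x : U) :
    extendSection s x = s x := by
  simp [extendSection]

variable {𝕜 : Type*} [NontriviallyNormedField 𝕜]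
  {E : Type*} [NormedAddCommGroup E] [NormedSpace 𝕜 E]
  {X : Type*} [TopologicalSpace X] [ChartedSpace E X]
  {n : ℕ∞ω}
  {F : Type*} [NormedAddCommGroup F] [NormedSpace 𝕜 F]
  {A : X → Type*} [TopologicalSpace (TotalSpace F A)]
  [∀ x, TopologicalSpace (A x)] [FiberBundle F A]

theorem isSectionOn_restrict_iff {U : Opens X} {s : ∀ x, A x} :
    IsSectionOn 𝕜 E n F A U (fun x => s x) ↔ ∀ x ∈ U,
      ContMDiffAt 𝓘(𝕜, E) (𝓘(𝕜, E).prod 𝓘(𝕜, F)) n (fun y => TotalSpace.mk' F y (s y)) x :=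
  ⟨fun h x hx => (contMDiffAt_subtype_iff (f := fun y => TotalSpace.mk' F y (s y))).1 (h ⟨x, hx⟩),
    fun h x => (contMDiffAt_subtype_iff (f := fun y => TotalSpace.mk' F y (s y))).2 (h x x.2)⟩

theorem isSectionOn_iff_extendSection [∀ x, AddCommGroup (A x)] {U : Opens X} {s : ∀ x : U, A x} :
    IsSectionOn 𝕜 E n F A U s ↔ ∀ x ∈ U, ContMDiffAt 𝓘(𝕜, E) (𝓘(𝕜, E).prod 𝓘(𝕜, F)) n
      (fun y => TotalSpace.mk' F y (extendSection s y)) x := by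
  rw [← isSectionOn_restrict_iff]
  simp only [extendSection_apply]

end Extension

/-- The derivative of a vector-valued function on a manifold, as a map between model spaces. -/
def modelDeriv (𝕜 : Type*) [NontriviallyNormedField 𝕜]
    {E : Type*} [NormedAddCommGroup E] [NormedSpace 𝕜 E]
    {X : Type*} [TopologicalSpace X] [ChartedSpace E X]
    {F : Type*} [NormedAddCommGroup F] [NormedSpace 𝕜 F] (f : X → F) (x : X) : E →L[𝕜] F :=
  mfderiv 𝓘(𝕜, E) 𝓘(𝕜, F) f x

theorem Filter.EventuallyEq.modelDeriv_eq {𝕜 : Type*} [NontriviallyNormedField 𝕜]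
    {E : Type*} [NormedAddCommGroup E] [NormedSpace 𝕜 E]
    {X : Type*} [TopologicalSpace X] [ChartedSpace E X]
    {F : Type*} [NormedAddCommGroup F] [NormedSpace 𝕜 F] {f g : X → F} {x : X}
    (h : f =ᶠ[nhds x] g) : modelDeriv (E := E) 𝕜 f x = modelDeriv 𝕜 g x :=
  h.mfderiv_eq

/-! ### Sections in a trivialization, and constant sections. -/

section Coordinates

variable {E : Type*} [NormedAddCommGroup E] [NormedSpace ℂ E]
  {X : Type*} [TopologicalSpace X] [ChartedSpace E X]
  {F : Type*} [NormedAddCommGroup F] [NormedSpace ℂ F]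
  {A : X → Type*} [TopologicalSpace (TotalSpace F A)] [∀ x, TopologicalSpace (A x)]
  [FiberBundle F A] [∀ x, AddCommGroup (A x)] [∀ x, Module ℂ (A x)] [VectorBundle ℂ F A]
  (e : Trivialization F (π F A)) [MemTrivializationAtlas e]

/-- The domain of a trivialization, as a bundled open set. -/
def Bundle.Trivialization.opens {B F : Type*} {A : B → Type*} [TopologicalSpace B]
    [TopologicalSpace F] [TopologicalSpace (TotalSpace F A)] (e : Trivialization F (π F A)) :
    Opens B :=
  ⟨e.baseSet, e.open_baseSet⟩

/-- The expression of a section in a trivialization. -/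
def sectionCoord (V : ∀ y, A y) (y : X) : F :=
  e.continuousLinearMapAt ℂ y (V y)

theorem sectionCoord_eventuallyEq (V : ∀ y, A y) {x : X} (hx : x ∈ e.baseSet) :
    sectionCoord e V =ᶠ[nhds x] fun y => (e ⟨y, V y⟩).2 := by
  filter_upwards [e.open_baseSet.mem_nhds hx] with y hy
  rw [sectionCoord, e.continuousLinearMapAt_apply ℂ, e.linearMapAt_apply, if_pos hy]

theorem sectionCoord_congr {V V' : ∀ y, A y} {x : X} (h : ∀ᶠ y in nhds x, V y = V' y) :
    sectionCoord e V =ᶠ[nhds x] sectionCoord e V' := by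
  filter_upwards [h] with y hy
  rw [sectionCoord, sectionCoord, hy]

theorem symmL_sectionCoord (V : ∀ y, A y) {x : X} (hx : x ∈ e.baseSet) :
    e.symmL ℂ x (sectionCoord e V x) = V x :=
  e.symmL_continuousLinearMapAt hx _

theorem sectionCoord_symmL (f : X → F) {x : X} (hx : x ∈ e.baseSet) :
    sectionCoord e (fun y => e.symmL ℂ y (f y)) x = f x :=
  e.continuousLinearMapAt_symmL hx _

theorem contMDiffAt_sectionCoord_iff {n : ℕ∞ω} [ContMDiffVectorBundle n F A 𝓘(ℝ, E)]
    {V : ∀ y, A y} {x : X} (hx : x ∈ e.baseSet) :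
    ContMDiffAt 𝓘(ℝ, E) 𝓘(ℝ, F) n (sectionCoord e V) x ↔
      ContMDiffAt 𝓘(ℝ, E) (𝓘(ℝ, E).prod 𝓘(ℝ, F)) n (fun y => TotalSpace.mk' F y (V y)) x := by
  rw [e.contMDiffAt_section_iff hx]
  exact (sectionCoord_eventuallyEq e V hx).contMDiffAt_iff

theorem contMDiffAt_sectionCoord_iff_complex {n : ℕ∞ω} [ContMDiffVectorBundle n F A 𝓘(ℂ, E)]
    {V : ∀ y, A y} {x : X} (hx : x ∈ e.baseSet) :
    ContMDiffAt 𝓘(ℂ, E) 𝓘(ℂ, F) n (sectionCoord e V) x ↔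
      ContMDiffAt 𝓘(ℂ, E) (𝓘(ℂ, E).prod 𝓘(ℂ, F)) n (fun y => TotalSpace.mk' F y (V y)) x := by
  rw [e.contMDiffAt_section_iff hx]
  exact (sectionCoord_eventuallyEq e V hx).contMDiffAt_iff

variable [ContMDiffVectorBundle ω F A 𝓘(ℂ, E)]

theorem contMDiffAt_constSection (u : F) {x : X} (hx : x ∈ e.baseSet) :
    ContMDiffAt 𝓘(ℂ, E) (𝓘(ℂ, E).prod 𝓘(ℂ, F)) ω
      (fun y => TotalSpace.mk' F y (e.symmL ℂ y u : A y)) x := by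
  rw [← contMDiffAt_sectionCoord_iff_complex e hx]
  refine (contMDiffAt_const (c := u)).congr_of_eventuallyEq ?_
  filter_upwards [e.open_baseSet.mem_nhds hx] with y hy
  exact sectionCoord_symmL e (fun _ => u) hy

/-- The holomorphic sections which are constant in a trivialization. -/
def constSection : F →ₗ[ℂ] SectionsOn ℂ E ω F A e.opens where
  toFun u := ⟨fun y => e.symmL ℂ (y : X) u,
    isSectionOn_restrict_iff.2 fun _ hx => contMDiffAt_constSection e u hx⟩
  map_add' u v := by ext y; exact map_add (e.symmL ℂ (y : X)) u v
  map_smul' c u := by ext y; exact map_smul (e.symmL ℂ (y : X)) c u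

theorem extendSection_constSection (u : F) (y : X) :
    extendSection (constSection (E := E) e u).1 y = e.symmL ℂ y u := by
  by_cases hy : y ∈ e.opens
  · exact extendSection_apply _ ⟨y, hy⟩
  -- Off the base set `symmL` takes the default value zero, in agreement with extension by zero.
  · rw [extendSection, dif_neg hy, e.symmL_apply_of_notMem hy]

/-- The complex coordinates of a section over an open subset on which the bundle is trivialized,
in a basis of the fibre. -/
def coordFunction {ι : Type*} [FiniteDimensional ℂ F] (b : Module.Basis ι ℂ F) (i : ι) {U : Opens X}
    (hU : U ≤ e.opens) (W : SectionsOn ℂ E ω F A U) : C^ω⟮𝓘(ℂ, E), U; ℂ⟯ :=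
  ⟨fun y => b.coord i (sectionCoord e (extendSection W.1) y), fun x => by
    have h := (isSectionOn_iff_extendSection.1 W.2) x x.2
    rw [← contMDiffAt_sectionCoord_iff_complex e (hU x.2)] at h
    exact (contMDiffAt_subtype_iff
      (f := fun y => b.coord i (sectionCoord e (extendSection W.1) y))).2
      ((LinearMap.toContinuousLinearMap (b.coord i)).contMDiff.contMDiffAt.comp _ h)⟩

end Coordinates

section ExtendLinear

variable {X : Type*} [TopologicalSpace X] {A : X → Type*} [∀ x, AddCommGroup (A x)] {U : Opens X}

theorem extendSection_add (s t : ∀ x : U, A x) (y : X) :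
    extendSection (s + t) y = extendSection s y + extendSection t y := by
  by_cases hy : y ∈ U <;> simp [extendSection, hy]

theorem extendSection_smul {R : Type*} [Semiring R] [∀ x, Module R (A x)] (c : R)
    (s : ∀ x : U, A x) (y : X) :
    extendSection (c • s) y = c • extendSection s y := by
  by_cases hy : y ∈ U <;> simp [extendSection, hy]

/-- Extensions by zero of a section and of its restriction agree on the smaller open subset. -/
theorem extendSection_inclusion {U' : Opens X} (h : U' ≤ U) (s : ∀ x : U, A x) {y : X}
    (hy : y ∈ U') :
    extendSection (fun x : U' => s (Opens.inclusion h x)) y = extendSection s y := by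
  rw [extendSection, extendSection, dif_pos hy, dif_pos (h hy)]

end ExtendLinear

/-! ### The holomorphic bracket in a trivialization. -/

section Bracket

variable {E : Type*} [NormedAddCommGroup E] [NormedSpace ℂ E]
  {X : Type*} [TopologicalSpace X] [ChartedSpace E X]
  {F : Type*} [NormedAddCommGroup F] [NormedSpace ℂ F]
  {A : X → Type*} [TopologicalSpace (TotalSpace F A)] [∀ x, TopologicalSpace (A x)]
  [FiberBundle F A] [∀ x, AddCommGroup (A x)] [∀ x, Module ℂ (A x)] [VectorBundle ℂ F A]

theorem SheafLieStructure.lie_swap (S : SheafLieStructure ℂ E ω F A) {U : Opens X}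
    (V W : SectionsOn ℂ E ω F A U) : S.lie U V W = -S.lie U W V :=
  (LinearMap.IsAlt.neg (B := S.lie U) (S.lie_self U) W V).symm

theorem mdifferentiableAt_sectionCoord_extendSection [ContMDiffVectorBundle ω F A 𝓘(ℂ, E)]
    (e : Trivialization F (π F A)) [MemTrivializationAtlas e]
    {U : Opens X} (W : SectionsOn ℂ E ω F A U)
    {x : X} (hx : x ∈ U) (hxe : x ∈ e.baseSet) :
    MDifferentiableAt 𝓘(ℂ, E) 𝓘(ℂ, F) (sectionCoord e (extendSection W.1)) x := by
  refine ContMDiffAt.mdifferentiableAt (n := ω) ?_ (by simp)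
  exact (contMDiffAt_sectionCoord_iff_complex e hxe).2 (isSectionOn_iff_extendSection.1 W.2 x hx)

variable [FiniteDimensional ℂ F] [IsManifold 𝓘(ℂ, E) ω X] [ContMDiffVectorBundle ω F A 𝓘(ℂ, E)]
  (H : HolomorphicLieAlgebroid E F A)
  (e : Trivialization F (π F A)) [MemTrivializationAtlas e]

/-- The anchor, as a real linear map from the fibre to the model space of the tangent spaces. -/
def HolomorphicLieAlgebroid.realAnchor (y : X) : A y →L[ℝ] E :=
  H.anchor.forgetComplex.toFun y

/-- The bracket with `W` differs from the bracket with a constant section by a derivative. -/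
theorem HolomorphicLieAlgebroid.lie_eq_lie_constSection_add {U : Opens X} (hU : U ≤ e.opens)
    (V W : SectionsOn ℂ E ω F A U) (x : U) :
    (H.bracket.lie U V W).1 x =
      (H.bracket.lie U V (SectionsOn.res hU
        (constSection e (sectionCoord e (extendSection W.1) x)))).1 x +
      e.symmL ℂ (x : X) (modelDeriv (E := E) ℂ (sectionCoord e (extendSection W.1)) (x : X)
        (H.realAnchor (x : X) (V.1 x))) := by
  -- The basis is complex because the Leibniz rule available here is for holomorphic complex-valued
  -- coefficients.
  let b := Module.finBasis ℂ F
  let Wc := sectionCoord e (extendSection W.1)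
  have hW : W = ∑ i, SectionsOn.fsmul (coordFunction e b i hU W)
      (SectionsOn.res hU (constSection e (b i))) := by
    ext y
    rw [AddSubmonoidClass.coe_finsetSum, Finset.sum_apply]
    change _ = ∑ i, b.coord i (Wc y) • e.symmL ℂ (y : X) (b i)
    simp_rw [← map_smul]
    rw [← map_sum]
    simp only [Module.Basis.coord_apply, b.sum_repr]
    rw [symmL_sectionCoord e _ (hU y.2), extendSection_apply]
  -- Freezing the coefficients of `W` at `x` gives the constant section with the same value at `x`.
  -- By the Leibniz rule, the two brackets with `V` differ at `x` only by derivatives of the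
  -- coefficients.
  have hc : SectionsOn.res hU (constSection (E := E) e (Wc x)) =
      ∑ i, b.coord i (Wc x) • SectionsOn.res hU (constSection e (b i)) := by
    ext y
    rw [AddSubmonoidClass.coe_finsetSum, Finset.sum_apply]
    change e.symmL ℂ (y : X) (Wc x) = ∑ i, b.coord i (Wc x) • e.symmL ℂ (y : X) (b i)
    simp_rw [← map_smul]
    rw [← map_sum]
    simp only [Module.Basis.coord_apply, b.sum_repr]
  have hd : ∀ (i) (v : E), derivAlong (coordFunction e b i hU W) x v =
      b.coord i (modelDeriv (E := E) ℂ Wc (x : X) v) := by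
    intro i v
    have hWd := mdifferentiableAt_sectionCoord_extendSection e W x.2 (hU x.2)
    let L : F →L[ℂ] ℂ := LinearMap.toContinuousLinearMap (b.coord i)
    have hL := (L.hasMFDerivAt (x := Wc x)).comp (x : X) hWd.hasMFDerivAt
    have h1 := mfderiv_comp_subtype_val (U := U) (x := x) hL.mdifferentiableAt v
    exact h1.trans (congrArg (fun T : E →L[ℂ] ℂ => T v) hL.mfderiv)
  conv_lhs => rw [hW]
  rw [hc, map_sum, map_sum, AddSubmonoidClass.coe_finsetSum, Finset.sum_apply,
    AddSubmonoidClass.coe_finsetSum, Finset.sum_apply]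
  have hs : e.symmL ℂ (x : X) (modelDeriv (E := E) ℂ Wc (x : X)
      (H.realAnchor (x : X) (V.1 x))) =
      ∑ i, b.coord i (modelDeriv (E := E) ℂ Wc (x : X)
      (H.realAnchor (x : X) (V.1 x))) • e.symmL ℂ (x : X) (b i) := by
    simp_rw [← map_smul]
    rw [← map_sum]
    congr 1
    exact (b.sum_repr _).symm
  rw [hs, ← Finset.sum_add_distrib]
  refine Finset.sum_congr rfl fun i _ => ?_
  rw [H.leibniz, add_comm, map_smul]
  exact congrArg₂ (· + ·) rfl (congrArg (· • _) (hd i _))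

/-- The structure functions of a holomorphic Lie algebroid in a trivialization: the expression at
`y` of the bracket of two constant sections. -/
def HolomorphicLieAlgebroid.structureMap (y : X) : F →L[ℝ] F →L[ℝ] F :=
  LinearMap.toContinuousBilinearMap <| LinearMap.mk₂ ℝ
    (fun u v => sectionCoord e (extendSection
      (H.bracket.lie e.opens (constSection e u) (constSection e v)).1) y)
    (fun u u' v => by
      simp only [sectionCoord, map_add, LinearMap.add_apply, Submodule.coe_add,
        extendSection_add])
    (fun c u v => by
      rw [← Complex.coe_smul c u, ← Complex.coe_smul]
      simp only [sectionCoord, map_smul, LinearMap.smul_apply, Submodule.coe_smul,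
        extendSection_smul])
    (fun u v v' => by
      simp only [sectionCoord, map_add, Submodule.coe_add, extendSection_add])
    (fun c u v => by
      rw [← Complex.coe_smul c v, ← Complex.coe_smul]
      simp only [sectionCoord, map_smul, Submodule.coe_smul, extendSection_smul])

theorem HolomorphicLieAlgebroid.structureMap_apply (y : X) (u v : F) :
    H.structureMap e y u v = sectionCoord e (extendSection
      (H.bracket.lie e.opens (constSection e u) (constSection e v)).1) y := rfl

theorem HolomorphicLieAlgebroid.structureMap_swap (y : X) (u v : F) :
    H.structureMap e y u v = -H.structureMap e y v u := by
  rw [structureMap_apply, structureMap_apply, SheafLieStructure.lie_swap, ← neg_one_smul ℂ,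
    sectionCoord, Submodule.coe_smul, extendSection_smul, map_smul, neg_one_smul]
  rfl

/-- The expression in the trivialization `e` of the bracket of two sections. -/
def HolomorphicLieAlgebroid.bracketCoord (V W : ∀ y, A y) (y : X) : F :=
  H.structureMap e y (sectionCoord e V y) (sectionCoord e W y) +
    modelDeriv ℝ (sectionCoord e W) y (H.realAnchor y (V y)) -
    modelDeriv ℝ (sectionCoord e V) y (H.realAnchor y (W y))

/-- The bracket of two sections, computed in the trivialization `e`. -/
def HolomorphicLieAlgebroid.trivBracket (V W : ∀ y, A y) (y : X) : A y :=
  e.symmL ℂ y (H.bracketCoord e V W y)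

theorem HolomorphicLieAlgebroid.bracketCoord_swap (V W : ∀ y, A y) (y : X) :
    H.bracketCoord e V W y = -H.bracketCoord e W V y := by
  rw [bracketCoord, bracketCoord, H.structureMap_swap]
  abel

/-- The bracket computed in a trivialization only depends on the germs of the sections. -/
theorem HolomorphicLieAlgebroid.bracketCoord_congr {V V' W W' : ∀ y, A y} {x : X}
    (hV : ∀ᶠ y in nhds x, V y = V' y) (hW : ∀ᶠ y in nhds x, W y = W' y) :
    H.bracketCoord e V W x = H.bracketCoord e V' W' x := by
  have hV' := sectionCoord_congr e hV
  have hW' := sectionCoord_congr e hW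
  rw [bracketCoord, bracketCoord, hV'.eq_of_nhds, hW'.eq_of_nhds, hV.self_of_nhds, hW.self_of_nhds,
    hV'.modelDeriv_eq, hW'.modelDeriv_eq]

/-- On holomorphic sections, the bracket is computed by its expression in a trivialization. -/
theorem HolomorphicLieAlgebroid.lie_eq_trivBracket {U : Opens X} (V W : SectionsOn ℂ E ω F A U)
    (x : U) (hx : (x : X) ∈ e.baseSet) :
    (H.bracket.lie U V W).1 x = H.trivBracket e (extendSection V.1) (extendSection W.1) x := by
  -- Constant sections live only over `e.opens`, so everything is restricted to the intersection,
  -- which is harmless in a sheaf of Lie algebras.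
  have hU : U ⊓ e.opens ≤ U := inf_le_left
  have he : U ⊓ e.opens ≤ e.opens := inf_le_right
  let x' : ↥(U ⊓ e.opens) := ⟨x, x.2, hx⟩
  have h0 : (H.bracket.lie U V W).1 x =
      (H.bracket.lie _ (SectionsOn.res hU V) (SectionsOn.res hU W)).1 x' := by
    rw [H.bracket.lie_res]
    rfl
  have hres : ∀ V : SectionsOn ℂ E ω F A U, ∀ᶠ y in nhds (x : X),
      extendSection (SectionsOn.res hU V).1 y = extendSection V.1 y := fun V => by
    filter_upwards [(U ⊓ e.opens).isOpen.mem_nhds x'.2] with y hy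
    exact extendSection_inclusion hU V.1 hy
  have hd : ∀ V : SectionsOn ℂ E ω F A U, ∀ v : E, modelDeriv (E := E) ℂ
      (sectionCoord e (extendSection (SectionsOn.res hU V).1)) (x : X) v =
      modelDeriv ℝ (sectionCoord e (extendSection V.1)) (x : X) v := fun V v => by
    have h := mfderiv_forgetComplex (mdifferentiableAt_sectionCoord_extendSection e V x.2 hx) v
    refine Eq.trans ?_ h.symm
    exact congrArg (fun T : E →L[ℂ] F => T v) (sectionCoord_congr e (hres V)).modelDeriv_eq
  have hval : ∀ V : SectionsOn ℂ E ω F A U,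
      sectionCoord e (extendSection (SectionsOn.res hU V).1) x =
        sectionCoord e (extendSection V.1) x := fun V =>
    (sectionCoord_congr e (hres V)).eq_of_nhds
  have hc : (SectionsOn.res he (constSection (E := E) e (sectionCoord e (extendSection W.1) x))).1 x' =
      W.1 x :=
    (symmL_sectionCoord e _ hx).trans (extendSection_apply _ x)
  have hB : ∀ u v, (H.bracket.lie _ (SectionsOn.res he (constSection e u))
      (SectionsOn.res he (constSection e v))).1 x' = e.symmL ℂ (x : X) (H.structureMap e x u v) :=
    fun u v => by
    rw [H.bracket.lie_res, H.structureMap_apply, symmL_sectionCoord e _ hx]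
    exact (extendSection_apply _ (⟨x, hx⟩ : e.opens)).symm
  -- The second argument is frozen, the arguments are exchanged by antisymmetry, and the other
  -- section is frozen in turn. Each freezing leaves one derivative term.
  rw [h0, H.lie_eq_lie_constSection_add e he, SheafLieStructure.lie_swap, Submodule.coe_neg,
    Pi.neg_apply, H.lie_eq_lie_constSection_add e he, hB, H.structureMap_swap]
  change -(_ + e.symmL ℂ (x : X) (modelDeriv (E := E) ℂ _ (x : X) (H.realAnchor x _))) +
    e.symmL ℂ (x : X) (modelDeriv (E := E) ℂ _ (x : X) (H.realAnchor x _)) = _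
  rw [hd, hd, hval, hval, hc, trivBracket, bracketCoord, extendSection_apply, extendSection_apply,
    ← map_add, ← map_neg, ← map_add]
  congr 1
  abel

end Bracket

/-! ### Product and sum rules on a manifold. -/

section ModelDeriv

variable {𝕜 : Type*} [NontriviallyNormedField 𝕜]
  {E : Type*} [NormedAddCommGroup E] [NormedSpace 𝕜 E]
  {X : Type*} [TopologicalSpace X] [ChartedSpace E X]
  {F : Type*} [NormedAddCommGroup F] [NormedSpace 𝕜 F]
  {G : Type*} [NormedAddCommGroup G] [NormedSpace 𝕜 G]

theorem MDifferentiableAt.differentiableAt_comp_extChartAt_symm {f : X → F} {x : X}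
    (hf : MDifferentiableAt 𝓘(𝕜, E) 𝓘(𝕜, F) f x) :
    DifferentiableAt 𝕜 (f ∘ (extChartAt 𝓘(𝕜, E) x).symm) (extChartAt 𝓘(𝕜, E) x x) := by
  have := hf.differentiableWithinAt_writtenInExtChartAt
  rw [show Set.range 𝓘(𝕜, E) = Set.univ by simp] at this
  exact differentiableWithinAt_univ.1 this

theorem modelDeriv_eq_fderiv {f : X → F} {x : X} (hf : MDifferentiableAt 𝓘(𝕜, E) 𝓘(𝕜, F) f x) :
    modelDeriv (E := E) 𝕜 f x =
      fderiv 𝕜 (f ∘ (extChartAt 𝓘(𝕜, E) x).symm) (extChartAt 𝓘(𝕜, E) x x) := by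
  have h : fderivWithin 𝕜 (f ∘ (extChartAt 𝓘(𝕜, E) x).symm) (Set.range 𝓘(𝕜, E))
      (extChartAt 𝓘(𝕜, E) x x) =
      fderiv 𝕜 (f ∘ (extChartAt 𝓘(𝕜, E) x).symm) (extChartAt 𝓘(𝕜, E) x x) := by
    rw [show Set.range 𝓘(𝕜, E) = Set.univ by simp, fderivWithin_univ]
  exact hf.mfderiv.trans h

theorem modelDeriv_clm_apply {h : X → F →L[𝕜] G} {f : X → F} {x : X}
    (hh : MDifferentiableAt 𝓘(𝕜, E) 𝓘(𝕜, F →L[𝕜] G) h x)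
    (hf : MDifferentiableAt 𝓘(𝕜, E) 𝓘(𝕜, F) f x) (v : E) :
    modelDeriv 𝕜 (fun y => h y (f y)) x v =
      h x (modelDeriv 𝕜 f x v) + modelDeriv 𝕜 h x v (f x) := by
  have hc : MDifferentiableAt 𝓘(𝕜, E) 𝓘(𝕜, G) (fun y => h y (f y)) x := hh.clm_apply hf
  have h1 := fderiv_clm_apply hh.differentiableAt_comp_extChartAt_symm
    hf.differentiableAt_comp_extChartAt_symm
  rw [modelDeriv_eq_fderiv hc, modelDeriv_eq_fderiv hf, modelDeriv_eq_fderiv hh]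
  refine (congrArg (fun T : E →L[𝕜] G => T v) h1).trans ?_
  simp

theorem modelDeriv_smul {g : X → 𝕜} {f : X → F} {x : X}
    (hg : MDifferentiableAt 𝓘(𝕜, E) 𝓘(𝕜, 𝕜) g x)
    (hf : MDifferentiableAt 𝓘(𝕜, E) 𝓘(𝕜, F) f x) (v : E) :
    modelDeriv 𝕜 (fun y => g y • f y) x v =
      g x • modelDeriv 𝕜 f x v + modelDeriv 𝕜 g x v • f x := by
  have hc : MDifferentiableAt 𝓘(𝕜, E) 𝓘(𝕜, F) (fun y => g y • f y) x := hg.smul hf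
  have h1 := fderiv_fun_smul hg.differentiableAt_comp_extChartAt_symm
    hf.differentiableAt_comp_extChartAt_symm
  rw [modelDeriv_eq_fderiv hc, modelDeriv_eq_fderiv hf, modelDeriv_eq_fderiv hg]
  refine (congrArg (fun T : E →L[𝕜] F => T v) h1).trans ?_
  simp

theorem modelDeriv_add {f g : X → F} {x : X}
    (hf : MDifferentiableAt 𝓘(𝕜, E) 𝓘(𝕜, F) f x)
    (hg : MDifferentiableAt 𝓘(𝕜, E) 𝓘(𝕜, F) g x) :
    modelDeriv (E := E) 𝕜 (fun y => f y + g y) x = modelDeriv 𝕜 f x + modelDeriv 𝕜 g x := by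
  have hc : MDifferentiableAt 𝓘(𝕜, E) 𝓘(𝕜, F) (fun y => f y + g y) x := hf.add hg
  have h1 := fderiv_fun_add hf.differentiableAt_comp_extChartAt_symm
    hg.differentiableAt_comp_extChartAt_symm
  rw [modelDeriv_eq_fderiv hc, modelDeriv_eq_fderiv hf, modelDeriv_eq_fderiv hg]
  exact h1

end ModelDeriv

/-! ### Independence of the trivialization. -/

section Independence

variable {E : Type*} [NormedAddCommGroup E] [NormedSpace ℂ E]
  {X : Type*} [TopologicalSpace X] [ChartedSpace E X]
  {F : Type*} [NormedAddCommGroup F] [NormedSpace ℂ F]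
  {A : X → Type*} [TopologicalSpace (TotalSpace F A)] [∀ x, TopologicalSpace (A x)]
  [FiberBundle F A] [∀ x, AddCommGroup (A x)] [∀ x, Module ℂ (A x)] [VectorBundle ℂ F A]
  (e e' : Trivialization F (π F A)) [MemTrivializationAtlas e] [MemTrivializationAtlas e']

/-- The transition map between two trivializations, as a real linear map. -/
def transitionMap (y : X) : F →L[ℝ] F :=
  ((e.continuousLinearMapAt ℂ y).comp (e'.symmL ℂ y)).restrictScalars ℝ

theorem mdifferentiableAt_transitionMap [ContMDiffVectorBundle ω F A 𝓘(ℂ, E)] {x : X}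
    (hx : x ∈ e.baseSet) (hx' : x ∈ e'.baseSet) :
    MDifferentiableAt 𝓘(ℝ, E) 𝓘(ℝ, F →L[ℝ] F) (transitionMap e e') x := by
  have h1 : ContMDiffAt 𝓘(ℂ, E) 𝓘(ℂ, F →L[ℂ] F) ω
      (fun y => (e'.coordChangeL ℂ e y : F →L[ℂ] F)) x :=
    contMDiffAt_coordChangeL (n := ω) hx' hx
  have h2 := ContMDiffAt.comp x
    (ContinuousLinearMap.restrictScalarsL ℂ F F ℝ ℝ).contMDiff.contMDiffAt h1.forgetComplex
  refine MDifferentiableAt.congr_of_eventuallyEq (h2.mdifferentiableAt (by simp)) ?_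
  filter_upwards [e.open_baseSet.mem_nhds hx, e'.open_baseSet.mem_nhds hx'] with y hy hy'
  ext v
  change e.continuousLinearMapAt ℂ y (e'.symmL ℂ y v) = e'.coordChangeL ℂ e y v
  rw [e'.coordChangeL_apply e ⟨hy', hy⟩, e'.symmL_apply hy', e.continuousLinearMapAt_apply ℂ,
    e.linearMapAt_apply, if_pos hy]

theorem sectionCoord_eq_transitionMap (V : ∀ y, A y) {y : X} (hy : y ∈ e'.baseSet) :
    sectionCoord e V y = transitionMap e e' y (sectionCoord e' V y) := by
  change _ = e.continuousLinearMapAt ℂ y (e'.symmL ℂ y _)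
  rw [symmL_sectionCoord e' V hy]
  rfl

variable [FiniteDimensional ℂ F] [IsManifold 𝓘(ℂ, E) ω X] [ContMDiffVectorBundle ω F A 𝓘(ℂ, E)]
  (H : HolomorphicLieAlgebroid E F A)

/-- The bracket computed in a trivialization does not depend on the trivialization. -/
theorem HolomorphicLieAlgebroid.trivBracket_eq {V W : ∀ y, A y} {x : X}
    (hx : x ∈ e.baseSet) (hx' : x ∈ e'.baseSet)
    (hV : MDifferentiableAt 𝓘(ℝ, E) 𝓘(ℝ, F) (sectionCoord e' V) x)
    (hW : MDifferentiableAt 𝓘(ℝ, E) 𝓘(ℝ, F) (sectionCoord e' W) x) :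
    H.trivBracket e V W x = H.trivBracket e' V W x := by
  have hh := mdifferentiableAt_transitionMap (E := E) e e' hx hx'
  have hD : ∀ V : ∀ y, A y, MDifferentiableAt 𝓘(ℝ, E) 𝓘(ℝ, F) (sectionCoord e' V) x →
      ∀ v : E, modelDeriv ℝ (sectionCoord e V) x v =
        transitionMap e e' x (modelDeriv ℝ (sectionCoord e' V) x v) +
          modelDeriv ℝ (transitionMap e e') x v (sectionCoord e' V x) := fun V hV v => by
    rw [← modelDeriv_clm_apply hh hV]
    refine congrArg (fun T : E →L[ℝ] F => T v) (Filter.EventuallyEq.modelDeriv_eq ?_)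
    filter_upwards [e'.open_baseSet.mem_nhds hx'] with y hy
    exact sectionCoord_eq_transitionMap e e' V hy
  have hconst : ∀ (u : F) (v : E), modelDeriv ℝ (sectionCoord e
      (extendSection (constSection (E := E) e' u).1)) x v =
      modelDeriv ℝ (transitionMap e e') x v u := fun u v => by
    have hu : sectionCoord e' (extendSection (constSection (E := E) e' u).1) =ᶠ[nhds x]
        fun _ => u := by
      filter_upwards [e'.open_baseSet.mem_nhds hx'] with y hy
      rw [sectionCoord, extendSection_constSection]
      exact e'.continuousLinearMapAt_symmL hy u
    have hum : MDifferentiableAt 𝓘(ℝ, E) 𝓘(ℝ, F) (fun _ : X => u) x := mdifferentiableAt_const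
    rw [hD _ (hum.congr_of_eventuallyEq hu), hu.eq_of_nhds, hu.modelDeriv_eq]
    have : modelDeriv (E := E) ℝ (fun _ : X => u) x = 0 := mfderiv_const
    rw [this]
    simp
  -- The constant sections of `e'` are holomorphic, so both trivializations compute their given
  -- bracket. This yields the transformation law of the structure functions.
  have hB : ∀ u w : F, e'.symmL ℂ x (H.structureMap e' x u w) =
      H.trivBracket e (extendSection (constSection e' u).1)
        (extendSection (constSection e' w).1) x := fun u w => by
    rw [← H.lie_eq_trivBracket e (U := e'.opens) _ _ ⟨x, hx'⟩ hx, H.structureMap_apply,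
      symmL_sectionCoord e' _ hx']
    exact extendSection_apply _ (⟨x, hx'⟩ : e'.opens)
  -- Changing trivialization adds to dV and dW terms that differentiate the transition map. They are
  -- the same terms that appear in the transformation law of the structure functions.
  have key : transitionMap e e' x (H.bracketCoord e' V W x) = H.bracketCoord e V W x := by
    have h1 : transitionMap e e' x (H.structureMap e' x (sectionCoord e' V x)
        (sectionCoord e' W x)) = _ :=
      congrArg (e.continuousLinearMapAt ℂ x) (hB (sectionCoord e' V x) (sectionCoord e' W x))
    rw [trivBracket, e.continuousLinearMapAt_symmL hx, bracketCoord, hconst, hconst,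
      extendSection_constSection, extendSection_constSection, symmL_sectionCoord e' V hx',
      symmL_sectionCoord e' W hx'] at h1
    have h2 : ∀ V : ∀ y, A y, sectionCoord e (extendSection
        (constSection (E := E) e' (sectionCoord e' V x)).1) x = sectionCoord e V x := fun V => by
      rw [sectionCoord, extendSection_constSection, symmL_sectionCoord e' V hx']
      rfl
    rw [h2, h2] at h1
    rw [bracketCoord, bracketCoord, map_sub, map_add, h1, hD W hW, hD V hV]
    abel
  rw [trivBracket, trivBracket, ← key]
  change e.symmL ℂ x (e.continuousLinearMapAt ℂ x _) = _
  rw [e.symmL_continuousLinearMapAt hx]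
  rfl

end Independence

/-- On a finite-dimensional source, regularity of an operator-valued map can be tested on each
vector. The criterion is used on an open set, hence the hypothesis on a whole neighbourhood. -/
theorem contDiffAt_clm_of_eventually {𝕜 : Type*} [NontriviallyNormedField 𝕜] [CompleteSpace 𝕜]
    {D E F : Type*} [NormedAddCommGroup D] [NormedSpace 𝕜 D] [NormedAddCommGroup E]
    [NormedSpace 𝕜 E] [NormedAddCommGroup F] [NormedSpace 𝕜 F] [FiniteDimensional 𝕜 E]
    {n : ℕ∞ω} {f : D → E →L[𝕜] F} {z : D}
    (h : ∀ᶠ w in nhds z, ∀ u, ContDiffAt 𝕜 n (fun y => f y u) w) : ContDiffAt 𝕜 n f z := by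
  obtain ⟨s, hs, hso, hz⟩ := eventually_nhds_iff.1 h
  refine ContDiffOn.contDiffAt (s := s) ?_ (hso.mem_nhds hz)
  exact contDiffOn_clm_apply.2 fun u w hw => (hs w hw u).contDiffWithinAt

theorem contDiffAt_localBracket {E F : Type*} [NormedAddCommGroup E] [NormedSpace ℝ E]
    [NormedAddCommGroup F] [NormedSpace ℝ F]
    {ρ : E → F →L[ℝ] E} {B : E → F →L[ℝ] F →L[ℝ] F} {V W : E → F} {z : E}
    (hρ : ContDiffAt ℝ ∞ ρ z) (hB : ContDiffAt ℝ ∞ B z) (hV : ContDiffAt ℝ ∞ V z)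
    (hW : ContDiffAt ℝ ∞ W z) : ContDiffAt ℝ ∞ (localBracket ρ B V W) z := by
  have hV' : ContDiffAt ℝ ∞ (fderiv ℝ V) z := hV.fderiv_right (by simp)
  have hW' : ContDiffAt ℝ ∞ (fderiv ℝ W) z := hW.fderiv_right (by simp)
  exact (((hB.clm_apply hV).clm_apply hW).add (hW'.clm_apply (hρ.clm_apply hV))).sub
    (hV'.clm_apply (hρ.clm_apply hW))

/-! ### Passing between neighbourhoods in the manifold and in a chart. -/

section Preliminaries

variable {E : Type*} [NormedAddCommGroup E] [NormedSpace ℂ E]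
  {X : Type*} [TopologicalSpace X] [ChartedSpace E X]
  {F : Type*} [NormedAddCommGroup F] [NormedSpace ℂ F]
  {A : X → Type*} [TopologicalSpace (TotalSpace F A)] [∀ x, TopologicalSpace (A x)]
  [FiberBundle F A] [∀ x, AddCommGroup (A x)] [∀ x, Module ℂ (A x)]

theorem eventually_extChartAt_symm {x₀ x : X} (hx : x ∈ (chartAt E x₀).source) {p : X → Prop}
    (hp : ∀ᶠ y in nhds x, p y) :
    ∀ᶠ z in nhds (extChartAt 𝓘(ℝ, E) x₀ x), ∃ y ∈ (chartAt E x₀).source, p y ∧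
      z = extChartAt 𝓘(ℝ, E) x₀ y := by
  have hx' : x ∈ (extChartAt 𝓘(ℝ, E) x₀).source := by simpa using hx
  have h1 : Filter.Tendsto (extChartAt 𝓘(ℝ, E) x₀).symm (nhds (extChartAt 𝓘(ℝ, E) x₀ x))
      (nhds x) := by
    have := continuousAt_extChartAt_symm'' (I := 𝓘(ℝ, E))
      ((extChartAt 𝓘(ℝ, E) x₀).map_source hx')
    rw [ContinuousAt, (extChartAt 𝓘(ℝ, E) x₀).left_inv hx'] at this
    exact this
  filter_upwards [h1.eventually hp, (isOpen_extChartAt_target x₀).mem_nhds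
    ((extChartAt 𝓘(ℝ, E) x₀).map_source hx')] with z hz hz'
  refine ⟨_, ?_, hz, ((extChartAt 𝓘(ℝ, E) x₀).right_inv hz').symm⟩
  simpa using (extChartAt 𝓘(ℝ, E) x₀).map_target hz'

/-- The vector field attached by the anchor to a smooth section is smooth. -/
theorem AnchorMap.contMDiffAt_apply [IsManifold 𝓘(ℝ, E) 1 X]
    (ρ : AnchorMap ℝ E ∞ F A) {V : ∀ y, A y} {x : X}
    (hV : ContMDiffAt 𝓘(ℝ, E) (𝓘(ℝ, E).prod 𝓘(ℝ, F)) ∞ (fun y => TotalSpace.mk' F y (V y)) x) :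
    ContMDiffAt 𝓘(ℝ, E) 𝓘(ℝ, E).tangent ∞
      (fun y => (⟨y, ρ.toFun y (V y)⟩ : TangentBundle 𝓘(ℝ, E) X)) x :=
  (ρ.contMDiff_toFun _).comp x hV

variable [VectorBundle ℂ F A] [ContMDiffVectorBundle ω F A 𝓘(ℂ, E)]
  {e : Trivialization F (π F A)} [MemTrivializationAtlas e]

theorem contMDiffAt_constSection_real (u : F) {x : X} (hx : x ∈ e.baseSet) :
    ContMDiffAt 𝓘(ℝ, E) (𝓘(ℝ, E).prod 𝓘(ℝ, F)) ∞
      (fun y => TotalSpace.mk' F y (e.symmL ℂ y u : A y)) x := by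
  rw [← contMDiffAt_sectionCoord_iff e hx]
  have h := (contMDiffAt_sectionCoord_iff_complex e hx).2 (contMDiffAt_constSection (E := E) e u hx)
  exact h.forgetComplex.of_le le_top

end Preliminaries

/-! ### The anchor and structure functions in a chart. -/

section Chart

variable {E : Type*} [NormedAddCommGroup E] [NormedSpace ℂ E]
  {X : Type*} [TopologicalSpace X] [ChartedSpace E X] [IsManifold 𝓘(ℂ, E) ω X]
  {F : Type*} [NormedAddCommGroup F] [NormedSpace ℂ F] [FiniteDimensional ℂ F]
  {A : X → Type*} [TopologicalSpace (TotalSpace F A)] [∀ x, TopologicalSpace (A x)]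
  [FiberBundle F A] [∀ x, AddCommGroup (A x)] [∀ x, Module ℂ (A x)] [VectorBundle ℂ F A]
  [ContMDiffVectorBundle ω F A 𝓘(ℂ, E)]
  (H : HolomorphicLieAlgebroid E F A)
  (e : Trivialization F (π F A)) [MemTrivializationAtlas e] (x₀ : X)

/-- The anchor in the chart at `x₀` and the trivialization `e`. -/
def HolomorphicLieAlgebroid.anchorCoord (z : E) : F →L[ℝ] E :=
  (modelDeriv ℝ (extChartAt 𝓘(ℝ, E) x₀) ((extChartAt 𝓘(ℝ, E) x₀).symm z)).comp
    ((H.realAnchor ((extChartAt 𝓘(ℝ, E) x₀).symm z)).comp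
      ((e.symmL ℂ ((extChartAt 𝓘(ℝ, E) x₀).symm z)).restrictScalars ℝ))

/-- The structure functions in the chart at `x₀` and the trivialization `e`. -/
def HolomorphicLieAlgebroid.structureCoord (z : E) : F →L[ℝ] F →L[ℝ] F :=
  H.structureMap e ((extChartAt 𝓘(ℝ, E) x₀).symm z)

variable {e x₀}

/-- Evaluated on a fixed vector, this is the chart expression of the vector field attached to a
constant section. -/
theorem HolomorphicLieAlgebroid.contDiffAt_anchorCoord {x : X} (hx : x ∈ (chartAt E x₀).source)
    (hxe : x ∈ e.baseSet) :
    ContDiffAt ℝ ∞ (H.anchorCoord e x₀) (extChartAt 𝓘(ℝ, E) x₀ x) := by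
  refine contDiffAt_clm_of_eventually ?_
  filter_upwards [eventually_extChartAt_symm hx (e.open_baseSet.mem_nhds hxe)] with z hz u
  obtain ⟨y, hy, hye, rfl⟩ := hz
  exact contDiffAt_fieldCoord hy (H.anchor.forgetComplex.contMDiffAt_apply (contMDiffAt_constSection_real u hye))

/-- Evaluated on two fixed vectors, this is the coordinate expression of a holomorphic section, the
bracket of two constant ones. The test on vectors is then applied once per argument. -/
theorem HolomorphicLieAlgebroid.contDiffAt_structureCoord {x : X}
    (hx : x ∈ (chartAt E x₀).source) (hxe : x ∈ e.baseSet) :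
    ContDiffAt ℝ ∞ (H.structureCoord e x₀) (extChartAt 𝓘(ℝ, E) x₀ x) := by
  have key : ∀ᶠ z in nhds (extChartAt 𝓘(ℝ, E) x₀ x), ∀ u v,
      ContDiffAt ℝ ∞ (fun w => H.structureCoord e x₀ w u v) z := by
    filter_upwards [eventually_extChartAt_symm hx (e.open_baseSet.mem_nhds hxe)] with z hz u v
    obtain ⟨y, hy, hye, rfl⟩ := hz
    have h := (contMDiffAt_sectionCoord_iff_complex e hye).2 (isSectionOn_iff_extendSection.1
      (H.bracket.lie e.opens (constSection e u) (constSection e v)).2 y hye)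
    have : IsManifold 𝓘(ℝ, E) ω X := IsManifold.forgetComplex ω
    exact (h.forgetComplex.contDiffAt_comp_extChartAt_symm hy).of_le le_top
  refine contDiffAt_clm_of_eventually ?_
  filter_upwards [key.eventually_nhds] with z hz u
  refine contDiffAt_clm_of_eventually ?_
  filter_upwards [hz] with w hw v using hw u v

theorem HolomorphicLieAlgebroid.anchorCoord_extChartAt {y : X} (hy : y ∈ (chartAt E x₀).source)
    (u : F) :
    H.anchorCoord e x₀ (extChartAt 𝓘(ℝ, E) x₀ y) u =
      modelDeriv ℝ (extChartAt 𝓘(ℝ, E) x₀) y (H.realAnchor y (e.symmL ℂ y u)) := by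
  have hinv : (extChartAt 𝓘(ℝ, E) x₀).symm (extChartAt 𝓘(ℝ, E) x₀ y) = y :=
    (extChartAt 𝓘(ℝ, E) x₀).left_inv (by simpa using hy)
  have h : ∀ z, H.anchorCoord e x₀ z u = modelDeriv ℝ (extChartAt 𝓘(ℝ, E) x₀)
      ((extChartAt 𝓘(ℝ, E) x₀).symm z) (H.realAnchor ((extChartAt 𝓘(ℝ, E) x₀).symm z)
        (e.symmL ℂ ((extChartAt 𝓘(ℝ, E) x₀).symm z) u)) := fun _ => rfl
  rw [h, hinv]

/-- The chart expression of the bracket of a Lie algebroid. -/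
theorem HolomorphicLieAlgebroid.bracketCoord_eq_localBracket {V W : ∀ y, A y} {y : X}
    (hy : y ∈ (chartAt E x₀).source) (hye : y ∈ e.baseSet)
    (hV : MDifferentiableAt 𝓘(ℝ, E) 𝓘(ℝ, F) (sectionCoord e V) y)
    (hW : MDifferentiableAt 𝓘(ℝ, E) 𝓘(ℝ, F) (sectionCoord e W) y) :
    H.bracketCoord e V W y =
      localBracket (H.anchorCoord e x₀) (H.structureCoord e x₀)
        (sectionCoord e V ∘ (extChartAt 𝓘(ℝ, E) x₀).symm)
        (sectionCoord e W ∘ (extChartAt 𝓘(ℝ, E) x₀).symm) (extChartAt 𝓘(ℝ, E) x₀ y) := by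
  have hinv : (extChartAt 𝓘(ℝ, E) x₀).symm (extChartAt 𝓘(ℝ, E) x₀ y) = y :=
    (extChartAt 𝓘(ℝ, E) x₀).left_inv (by simpa using hy)
  have hD : ∀ V W : ∀ y, A y, MDifferentiableAt 𝓘(ℝ, E) 𝓘(ℝ, F) (sectionCoord e W) y →
      modelDeriv ℝ (sectionCoord e W) y (H.realAnchor y (V y)) =
      fderiv ℝ (sectionCoord e W ∘ (extChartAt 𝓘(ℝ, E) x₀).symm) (extChartAt 𝓘(ℝ, E) x₀ y)
        (H.anchorCoord e x₀ (extChartAt 𝓘(ℝ, E) x₀ y) (sectionCoord e V y)) := by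
    intro V W hW
    refine (mfderiv_eq_fderiv_comp_extChartAt_symm hy hW _).trans ?_
    rw [H.anchorCoord_extChartAt hy, symmL_sectionCoord e V hye]
    rfl
  simp only [localBracket, bracketCoord, structureCoord, Function.comp_apply, hinv, hD V W hW,
    hD W V hV]

end Chart

/-! ### The bracket of smooth sections. -/

section SmoothBracket

variable {E : Type*} [NormedAddCommGroup E] [NormedSpace ℂ E]
  {X : Type*} [TopologicalSpace X] [ChartedSpace E X]
  {F : Type*} [NormedAddCommGroup F] [NormedSpace ℂ F]
  {A : X → Type*} [TopologicalSpace (TotalSpace F A)] [∀ x, TopologicalSpace (A x)]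
  [FiberBundle F A]

variable (E F) in
/-- A section is smooth near `x` if it is smooth at all points of a neighbourhood of `x`. -/
def IsSmoothNear (V : ∀ y, A y) (x : X) : Prop :=
  ∀ᶠ y in nhds x,
    ContMDiffAt 𝓘(ℝ, E) (𝓘(ℝ, E).prod 𝓘(ℝ, F)) ∞ (fun y => TotalSpace.mk' F y (V y)) y

variable [∀ x, AddCommGroup (A x)] [∀ x, Module ℂ (A x)] [VectorBundle ℂ F A]
  [ContMDiffVectorBundle ω F A 𝓘(ℂ, E)]
  {e : Trivialization F (π F A)} [MemTrivializationAtlas e]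
  {V W Z : ∀ y, A y} {x : X}

theorem IsSmoothNear.contMDiffAt_sectionCoord (hV : IsSmoothNear E F V x) (hx : x ∈ e.baseSet) :
    ContMDiffAt 𝓘(ℝ, E) 𝓘(ℝ, F) ∞ (sectionCoord e V) x :=
  (contMDiffAt_sectionCoord_iff e hx).2 hV.self_of_nhds

theorem IsSmoothNear.mdifferentiableAt_sectionCoord (hV : IsSmoothNear E F V x)
    (hx : x ∈ e.baseSet) : MDifferentiableAt 𝓘(ℝ, E) 𝓘(ℝ, F) (sectionCoord e V) x :=
  (hV.contMDiffAt_sectionCoord hx).mdifferentiableAt (by simp)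

variable [FiniteDimensional ℂ F] [IsManifold 𝓘(ℂ, E) ω X] (H : HolomorphicLieAlgebroid E F A)

/-- The bracket of smooth sections extending the bracket of a holomorphic Lie algebroid. -/
def HolomorphicLieAlgebroid.smoothBracket (V W : ∀ y, A y) (x : X) : A x :=
  H.trivBracket (trivializationAt F A x) V W x

/-- The trivialization in the definition changes with the point. Differentiating the bracket
requires a single one on a whole neighbourhood. -/
theorem HolomorphicLieAlgebroid.smoothBracket_eq_trivBracket (hV : IsSmoothNear E F V x)
    (hW : IsSmoothNear E F W x) (hx : x ∈ e.baseSet) :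
    H.smoothBracket V W x = H.trivBracket e V W x :=
  H.trivBracket_eq _ _ (mem_baseSet_trivializationAt F A x) hx
    (hV.mdifferentiableAt_sectionCoord hx) (hW.mdifferentiableAt_sectionCoord hx)

theorem HolomorphicLieAlgebroid.sectionCoord_smoothBracket (hV : IsSmoothNear E F V x)
    (hW : IsSmoothNear E F W x) (hx : x ∈ e.baseSet) :
    sectionCoord e (H.smoothBracket V W) x = H.bracketCoord e V W x := by
  rw [sectionCoord, H.smoothBracket_eq_trivBracket hV hW hx, trivBracket,
    e.continuousLinearMapAt_symmL hx]

/-- An equality of germs rather than of values, so that it can be differentiated: this gives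
smoothness of the bracket and access to iterated brackets. -/
theorem HolomorphicLieAlgebroid.sectionCoord_smoothBracket_comp {x₀ : X}
    (hx₀ : x ∈ (chartAt E x₀).source) (hx : x ∈ e.baseSet)
    (hV : IsSmoothNear E F V x) (hW : IsSmoothNear E F W x) :
    sectionCoord e (H.smoothBracket V W) ∘ (extChartAt 𝓘(ℝ, E) x₀).symm
      =ᶠ[nhds (extChartAt 𝓘(ℝ, E) x₀ x)]
      localBracket (H.anchorCoord e x₀) (H.structureCoord e x₀)
        (sectionCoord e V ∘ (extChartAt 𝓘(ℝ, E) x₀).symm)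
        (sectionCoord e W ∘ (extChartAt 𝓘(ℝ, E) x₀).symm) := by
  filter_upwards [eventually_extChartAt_symm hx₀
    (Filter.Eventually.and (e.open_baseSet.mem_nhds hx)
      (hV.eventually_nhds.and hW.eventually_nhds))] with z hz
  obtain ⟨y, hy, ⟨hye, hVy, hWy⟩, rfl⟩ := hz
  have hinv : (extChartAt 𝓘(ℝ, E) x₀).symm (extChartAt 𝓘(ℝ, E) x₀ y) = y :=
    (extChartAt 𝓘(ℝ, E) x₀).left_inv (by simpa using hy)
  rw [Function.comp_apply, hinv, H.sectionCoord_smoothBracket hVy hWy hye,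
    H.bracketCoord_eq_localBracket hy hye (IsSmoothNear.mdifferentiableAt_sectionCoord hVy hye)
      (IsSmoothNear.mdifferentiableAt_sectionCoord hWy hye)]

theorem IsSmoothNear.contDiffAt_comp_extChartAt_symm {x₀ : X}
    (hV : IsSmoothNear E F V x) (hx₀ : x ∈ (chartAt E x₀).source) (hx : x ∈ e.baseSet) :
    ContDiffAt ℝ ∞ (sectionCoord e V ∘ (extChartAt 𝓘(ℝ, E) x₀).symm) (extChartAt 𝓘(ℝ, E) x₀ x) := by
  have : IsManifold 𝓘(ℂ, E) ∞ X := IsManifold.of_le (n := ω) le_top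
  exact (hV.contMDiffAt_sectionCoord hx).contDiffAt_comp_extChartAt_symm hx₀

theorem HolomorphicLieAlgebroid.contMDiffAt_smoothBracket (hV : IsSmoothNear E F V x)
    (hW : IsSmoothNear E F W x) :
    ContMDiffAt 𝓘(ℝ, E) (𝓘(ℝ, E).prod 𝓘(ℝ, F)) ∞
      (fun y => TotalSpace.mk' F y (H.smoothBracket V W y)) x := by
  have : IsManifold 𝓘(ℂ, E) ∞ X := IsManifold.of_le (n := ω) le_top
  let e := trivializationAt F A x
  have hx : x ∈ e.baseSet := mem_baseSet_trivializationAt F A x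
  have hc := mem_chart_source E x
  rw [← contMDiffAt_sectionCoord_iff e hx]
  have h1 := contDiffAt_localBracket (H.contDiffAt_anchorCoord (e := e) hc hx)
    (H.contDiffAt_structureCoord (e := e) hc hx) (hV.contDiffAt_comp_extChartAt_symm hc hx)
    (hW.contDiffAt_comp_extChartAt_symm hc hx)
  have h2 := h1.congr_of_eventuallyEq (H.sectionCoord_smoothBracket_comp hc hx hV hW)
  refine (h2.contMDiffAt.comp x (contMDiffAt_extChartAt (I := 𝓘(ℝ, E)))).congr_of_eventuallyEq ?_
  filter_upwards [extChartAt_source_mem_nhds (I := 𝓘(ℝ, E)) x] with y hy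
  simp only [Function.comp_apply]
  rw [(extChartAt 𝓘(ℝ, E) x).left_inv hy]

theorem HolomorphicLieAlgebroid.isSmoothNear_smoothBracket (hV : IsSmoothNear E F V x)
    (hW : IsSmoothNear E F W x) : IsSmoothNear E F (H.smoothBracket V W) x := by
  filter_upwards [hV.eventually_nhds, hW.eventually_nhds] with y hVy hWy
  exact H.contMDiffAt_smoothBracket hVy hWy

theorem HolomorphicLieAlgebroid.smoothBracket_swap (V W : ∀ y, A y) (x : X) :
    H.smoothBracket V W x = -H.smoothBracket W V x := by
  rw [smoothBracket, smoothBracket, trivBracket, trivBracket, H.bracketCoord_swap, map_neg]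

theorem HolomorphicLieAlgebroid.smoothBracket_self (V : ∀ y, A y) (x : X) :
    H.smoothBracket V V x = 0 := by
  have h : H.bracketCoord (trivializationAt F A x) V V x = 0 := by
    have h := H.bracketCoord_swap (trivializationAt F A x) V V x
    rw [eq_neg_iff_add_eq_zero, ← two_smul ℝ] at h
    exact (smul_eq_zero.1 h).resolve_left two_ne_zero
  rw [smoothBracket, trivBracket, h, map_zero]

theorem HolomorphicLieAlgebroid.smoothBracket_congr {V' W' : ∀ y, A y}
    (hV : ∀ᶠ y in nhds x, V y = V' y) (hW : ∀ᶠ y in nhds x, W y = W' y) :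
    H.smoothBracket V W x = H.smoothBracket V' W' x := by
  rw [smoothBracket, smoothBracket, trivBracket, trivBracket, H.bracketCoord_congr _ hV hW]

theorem sectionCoord_real_smul (f : X → ℝ) (W : ∀ y, A y) (y : X) :
    sectionCoord e (fun y => f y • W y) y = f y • sectionCoord e W y := by
  rw [sectionCoord, ← Complex.coe_smul, map_smul, Complex.coe_smul]
  rfl

theorem HolomorphicLieAlgebroid.smoothBracket_add_right (hW : IsSmoothNear E F W x)
    (hZ : IsSmoothNear E F Z x) :
    H.smoothBracket V (fun y => W y + Z y) x = H.smoothBracket V W x + H.smoothBracket V Z x := by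
  have hx := mem_baseSet_trivializationAt F A x
  have h1 : sectionCoord (trivializationAt F A x) (fun y => W y + Z y) = fun y =>
      sectionCoord (trivializationAt F A x) W y + sectionCoord (trivializationAt F A x) Z y := by
    funext y
    exact map_add _ _ _
  rw [smoothBracket, smoothBracket, smoothBracket, trivBracket, trivBracket, trivBracket,
    ← map_add]
  congr 1
  simp only [bracketCoord]
  rw [h1, modelDeriv_add (hW.mdifferentiableAt_sectionCoord hx)
    (hZ.mdifferentiableAt_sectionCoord hx)]
  simp only [map_add, add_apply]
  abel

theorem HolomorphicLieAlgebroid.smoothBracket_smul_right {f : X → ℝ}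
    (hf : MDifferentiableAt 𝓘(ℝ, E) 𝓘(ℝ, ℝ) f x) (hW : IsSmoothNear E F W x) :
    H.smoothBracket V (fun y => f y • W y) x =
      modelDeriv ℝ f x (H.realAnchor x (V x)) • W x + f x • H.smoothBracket V W x := by
  have hx := mem_baseSet_trivializationAt F A x
  have h1 : sectionCoord (trivializationAt F A x) (fun y => f y • W y) = fun y =>
      f y • sectionCoord (trivializationAt F A x) W y := by
    funext y
    exact sectionCoord_real_smul f W y
  -- Real scalars are written as complex ones so that the complex linear map `symmL` can carry them
  -- out.
  have h2 : H.bracketCoord (trivializationAt F A x) V (fun y => f y • W y) x =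
      ((modelDeriv ℝ f x (H.realAnchor x (V x)) : ℝ) : ℂ) •
        sectionCoord (trivializationAt F A x) W x +
      ((f x : ℝ) : ℂ) • H.bracketCoord (trivializationAt F A x) V W x := by
    simp only [bracketCoord, Complex.coe_smul]
    rw [h1, modelDeriv_smul hf (hW.mdifferentiableAt_sectionCoord hx)]
    simp only [map_smul, smul_sub, smul_add]
    abel
  rw [smoothBracket, trivBracket, h2, map_add, map_smul, map_smul, symmL_sectionCoord _ _ hx,
    Complex.coe_smul, Complex.coe_smul]
  rfl

/-- On holomorphic sections, `smoothBracket` is the given bracket. -/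
theorem HolomorphicLieAlgebroid.lie_eq_smoothBracket {U : Opens X} (V W : SectionsOn ℂ E ω F A U)
    (x : U) :
    (H.bracket.lie U V W).1 x = H.smoothBracket (extendSection V.1) (extendSection W.1) x :=
  H.lie_eq_trivBracket _ V W x (mem_baseSet_trivializationAt F A (x : X))

end SmoothBracket

/-! ### Compatibility with the anchor and the Jacobi identity. -/

section Identities

variable {E : Type*} [NormedAddCommGroup E] [NormedSpace ℂ E]
  {X : Type*} [TopologicalSpace X] [ChartedSpace E X]
  {F : Type*} [NormedAddCommGroup F] [NormedSpace ℂ F]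
  {A : X → Type*} [TopologicalSpace (TotalSpace F A)] [∀ x, TopologicalSpace (A x)]
  [FiberBundle F A] [∀ x, AddCommGroup (A x)] [∀ x, Module ℂ (A x)] [VectorBundle ℂ F A]
  [ContMDiffVectorBundle ω F A 𝓘(ℂ, E)]
  {e : Trivialization F (π F A)} [MemTrivializationAtlas e]
  {V W Z : ∀ y, A y} {x : X}
  [FiniteDimensional ℂ F] [IsManifold 𝓘(ℂ, E) ω X] (H : HolomorphicLieAlgebroid E F A)

theorem HolomorphicLieAlgebroid.anchorCoord_self (x : X) (u : F) :
    H.anchorCoord e x (extChartAt 𝓘(ℝ, E) x x) u = H.realAnchor x (e.symmL ℂ x u) := by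
  rw [H.anchorCoord_extChartAt (mem_chart_source E x)]
  exact congrArg (fun T : E →L[ℝ] E => T _) (mfderiv_extChartAt_self (I := 𝓘(ℝ, E)) (x := x))

theorem HolomorphicLieAlgebroid.structureCoord_self (x : X) :
    H.structureCoord e x (extChartAt 𝓘(ℝ, E) x x) = H.structureMap e x := by
  rw [structureCoord, extChartAt_to_inv]

theorem HolomorphicLieAlgebroid.symmL_structureMap (hx : x ∈ e.baseSet) (u v : F) :
    e.symmL ℂ x (H.structureMap e x u v) =
      (H.bracket.lie e.opens (constSection e u) (constSection e v)).1 ⟨x, hx⟩ := by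
  rw [H.structureMap_apply, symmL_sectionCoord e _ hx]
  exact extendSection_apply _ (⟨x, hx⟩ : e.opens)

/-- The anchor is compatible with the brackets of constant sections, in coordinates. -/
theorem HolomorphicLieAlgebroid.anchorCoord_structureCoord [CompleteSpace E]
    (hx : x ∈ e.baseSet) (u v : F) :
    H.anchorCoord e x (extChartAt 𝓘(ℝ, E) x x)
        (H.structureCoord e x (extChartAt 𝓘(ℝ, E) x x) u v) =
      fderiv ℝ (fun z => H.anchorCoord e x z v) (extChartAt 𝓘(ℝ, E) x x)
        (H.anchorCoord e x (extChartAt 𝓘(ℝ, E) x x) u) -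
      fderiv ℝ (fun z => H.anchorCoord e x z u) (extChartAt 𝓘(ℝ, E) x x)
        (H.anchorCoord e x (extChartAt 𝓘(ℝ, E) x x) v) := by
  have hs : ∀ u : F, ContMDiffAt 𝓘(ℂ, E) 𝓘(ℂ, E).tangent ω (fun y =>
      (⟨y, H.anchor.toFun y (e.symmL ℂ y u)⟩ : TangentBundle 𝓘(ℂ, E) X)) x := fun u =>
    (H.anchor.contMDiff_toFun _).comp x (contMDiffAt_constSection e u hx)
  have hd : ∀ u : F, MDifferentiableAt 𝓘(ℂ, E) 𝓘(ℂ, E).tangent (fun y =>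
      (⟨y, H.anchor.toFun y (e.symmL ℂ y u)⟩ : TangentBundle 𝓘(ℂ, E) X)) x := fun u =>
    (hs u).mdifferentiableAt (by simp)
  rw [H.structureCoord_self, H.anchorCoord_self, H.symmL_structureMap hx]
  -- The holomorphic axiom is carried from the open submanifold to `X`, then from complex to real
  -- vector fields, then into the chart at `x`.
  refine (H.anchor_lie e.opens (constSection e u) (constSection e v) ⟨x, hx⟩).trans ?_
  refine (mlieBracket_subtype (U := e.opens) (x := ⟨x, hx⟩) (hd u) (hd v)).trans ?_
  refine (mlieBracket_forgetComplex (hs u) (hs v)).symm.trans ?_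
  exact mlieBracket_eq_lieBracket_fieldCoord _ _ x

theorem sectionCoord_constSection_eventuallyEq (hx : x ∈ e.baseSet) (u : F) :
    sectionCoord e (extendSection (constSection (E := E) e u).1) =ᶠ[nhds x] fun _ => u := by
  filter_upwards [e.open_baseSet.mem_nhds hx] with y hy
  rw [sectionCoord, extendSection_constSection]
  exact e.continuousLinearMapAt_symmL hy u

/-- The iterated bracket of constant sections, in coordinates. -/
theorem HolomorphicLieAlgebroid.lie_lie_constSection (hx : x ∈ e.baseSet) (u v w : F) :
    (H.bracket.lie e.opens (constSection e u)
      (H.bracket.lie e.opens (constSection e v) (constSection e w))).1 ⟨x, hx⟩ =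
    e.symmL ℂ x (H.structureCoord e x (extChartAt 𝓘(ℝ, E) x x) u
        (H.structureCoord e x (extChartAt 𝓘(ℝ, E) x x) v w) +
      fderiv ℝ (fun z => H.structureCoord e x z v w) (extChartAt 𝓘(ℝ, E) x x)
        (H.anchorCoord e x (extChartAt 𝓘(ℝ, E) x x) u)) := by
  have h1 := sectionCoord_constSection_eventuallyEq (E := E) hx u
  have h2 : modelDeriv (E := E) ℝ (fun _ : X => u) x = 0 := mfderiv_const
  have h3 : MDifferentiableAt 𝓘(ℝ, E) 𝓘(ℝ, F) (sectionCoord e (extendSection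
      (H.bracket.lie e.opens (constSection e v) (constSection e w)).1)) x :=
    (mdifferentiableAt_sectionCoord_extendSection e _ (U := e.opens) hx hx).forgetComplex
  -- The outer section is constant, so its derivative drops out. The coordinates of the inner
  -- bracket are by definition the structure functions.
  rw [H.lie_eq_trivBracket e (U := e.opens) _ _ ⟨x, hx⟩ hx, trivBracket, bracketCoord,
    h1.eq_of_nhds, h1.modelDeriv_eq, h2, modelDeriv_eq_fderiv h3, H.anchorCoord_self,
    H.structureCoord_self, extendSection_constSection]
  simp only [zero_apply, sub_zero]
  rfl

/-- The holomorphic Jacobi identity on constant sections, in the form that `localBracket_jacobi`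
requires. -/
theorem HolomorphicLieAlgebroid.structureCoord_jacobi (hx : x ∈ e.baseSet) (u v w : F) :
    (H.structureCoord e x (extChartAt 𝓘(ℝ, E) x x) u
        (H.structureCoord e x (extChartAt 𝓘(ℝ, E) x x) v w) +
      fderiv ℝ (fun z => H.structureCoord e x z v w) (extChartAt 𝓘(ℝ, E) x x)
        (H.anchorCoord e x (extChartAt 𝓘(ℝ, E) x x) u)) +
    (H.structureCoord e x (extChartAt 𝓘(ℝ, E) x x) v
        (H.structureCoord e x (extChartAt 𝓘(ℝ, E) x x) w u) +
      fderiv ℝ (fun z => H.structureCoord e x z w u) (extChartAt 𝓘(ℝ, E) x x)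
        (H.anchorCoord e x (extChartAt 𝓘(ℝ, E) x x) v)) +
    (H.structureCoord e x (extChartAt 𝓘(ℝ, E) x x) w
        (H.structureCoord e x (extChartAt 𝓘(ℝ, E) x x) u v) +
      fderiv ℝ (fun z => H.structureCoord e x z u v) (extChartAt 𝓘(ℝ, E) x x)
        (H.anchorCoord e x (extChartAt 𝓘(ℝ, E) x x) w)) = 0 := by
  have h := congrArg (fun s => s.1 (⟨x, hx⟩ : e.opens))
    (H.bracket.jacobi e.opens (constSection e u) (constSection e v) (constSection e w))
  change (H.bracket.lie e.opens _ _).1 ⟨x, hx⟩ + (H.bracket.lie e.opens _ _).1 ⟨x, hx⟩ +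
    (H.bracket.lie e.opens _ _).1 ⟨x, hx⟩ = 0 at h
  rw [H.lie_lie_constSection hx, H.lie_lie_constSection hx, H.lie_lie_constSection hx, ← map_add,
    ← map_add] at h
  have h' := congrArg (e.continuousLinearMapAt ℂ x) h
  rwa [e.continuousLinearMapAt_symmL hx, map_zero] at h'

theorem Filter.EventuallyEq.localBracket_eq {E F : Type*} [NormedAddCommGroup E] [NormedSpace ℝ E]
    [NormedAddCommGroup F] [NormedSpace ℝ F] {ρ : E → F →L[ℝ] E} {B : E → F →L[ℝ] F →L[ℝ] F}
    {V W W' : E → F} {z : E} (h : W =ᶠ[nhds z] W') :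
    localBracket ρ B V W z = localBracket ρ B V W' z := by
  rw [localBracket, localBracket, h.eq_of_nhds, h.fderiv_eq]

theorem HolomorphicLieAlgebroid.smoothBracket_smoothBracket
    (hV : IsSmoothNear E F V x) (hW : IsSmoothNear E F W x) (hZ : IsSmoothNear E F Z x)
    (hx : x ∈ e.baseSet) :
    H.smoothBracket V (H.smoothBracket W Z) x =
      e.symmL ℂ x (localBracket (H.anchorCoord e x) (H.structureCoord e x)
        (sectionCoord e V ∘ (extChartAt 𝓘(ℝ, E) x).symm)
        (localBracket (H.anchorCoord e x) (H.structureCoord e x)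
          (sectionCoord e W ∘ (extChartAt 𝓘(ℝ, E) x).symm)
          (sectionCoord e Z ∘ (extChartAt 𝓘(ℝ, E) x).symm)) (extChartAt 𝓘(ℝ, E) x x)) := by
  have hWZ := H.isSmoothNear_smoothBracket hW hZ
  have hc := mem_chart_source E x
  rw [H.smoothBracket_eq_trivBracket hV hWZ hx, trivBracket,
    H.bracketCoord_eq_localBracket hc hx (hV.mdifferentiableAt_sectionCoord hx)
      (hWZ.mdifferentiableAt_sectionCoord hx),
    (H.sectionCoord_smoothBracket_comp hc hx hW hZ).localBracket_eq]

theorem HolomorphicLieAlgebroid.smoothBracket_jacobi [CompleteSpace E]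
    (hV : IsSmoothNear E F V x) (hW : IsSmoothNear E F W x) (hZ : IsSmoothNear E F Z x) :
    H.smoothBracket V (H.smoothBracket W Z) x + H.smoothBracket W (H.smoothBracket Z V) x +
      H.smoothBracket Z (H.smoothBracket V W) x = 0 := by
  let e := trivializationAt F A x
  have hx : x ∈ e.baseSet := mem_baseSet_trivializationAt F A x
  have hc := mem_chart_source E x
  rw [H.smoothBracket_smoothBracket hV hW hZ hx, H.smoothBracket_smoothBracket hW hZ hV hx,
    H.smoothBracket_smoothBracket hZ hV hW hx, ← map_add, ← map_add, localBracket_jacobi, map_zero]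
  · exact (H.contDiffAt_anchorCoord hc hx).differentiableAt (by simp)
  · exact (H.contDiffAt_structureCoord hc hx).differentiableAt (by simp)
  · exact (hV.contDiffAt_comp_extChartAt_symm hc hx).of_le (by norm_cast)
  · exact (hW.contDiffAt_comp_extChartAt_symm hc hx).of_le (by norm_cast)
  · exact (hZ.contDiffAt_comp_extChartAt_symm hc hx).of_le (by norm_cast)
  · exact fun u v => H.structureMap_swap e _ u v
  · exact H.anchorCoord_structureCoord hx
  · exact H.structureCoord_jacobi hx

theorem HolomorphicLieAlgebroid.anchor_smoothBracket [CompleteSpace E]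
    (hV : IsSmoothNear E F V x) (hW : IsSmoothNear E F W x) :
    H.anchor.forgetComplex.toFun x (H.smoothBracket V W x) =
      VectorField.mlieBracket 𝓘(ℝ, E) (fun y => H.anchor.forgetComplex.toFun y (V y))
        (fun y => H.anchor.forgetComplex.toFun y (W y)) x := by
  let e := trivializationAt F A x
  have hx : x ∈ e.baseSet := mem_baseSet_trivializationAt F A x
  have hc := mem_chart_source E x
  have hfield : ∀ V : ∀ y, A y, fieldCoord ℝ x (fun y => H.anchor.forgetComplex.toFun y (V y))
      =ᶠ[nhds (extChartAt 𝓘(ℝ, E) x x)] fun z =>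
        H.anchorCoord e x z ((sectionCoord e V ∘ (extChartAt 𝓘(ℝ, E) x).symm) z) := fun V => by
    filter_upwards [eventually_extChartAt_symm hc (e.open_baseSet.mem_nhds hx)] with z hz
    obtain ⟨y, hy, hye, rfl⟩ := hz
    have hinv : (extChartAt 𝓘(ℝ, E) x).symm (extChartAt 𝓘(ℝ, E) x y) = y :=
      (extChartAt 𝓘(ℝ, E) x).left_inv (by simpa using hy)
    have h : sectionCoord e V ((extChartAt 𝓘(ℝ, E) x).symm (extChartAt 𝓘(ℝ, E) x y)) =
        sectionCoord e V y := by rw [hinv]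
    rw [Function.comp_apply, h, H.anchorCoord_extChartAt hy, symmL_sectionCoord e V hye, fieldCoord,
      hinv]
    rfl
  rw [mlieBracket_eq_lieBracket_fieldCoord]
  -- Near the base point both fields are the local anchor applied to coordinates, so
  -- `localBracket_anchor` applies.
  refine Eq.trans ?_ ((hfield V).lieBracket_vectorField_eq (hfield W)).symm
  rw [← localBracket_anchor (B := H.structureCoord e x), H.anchorCoord_self,
    ← H.bracketCoord_eq_localBracket hc hx (hV.mdifferentiableAt_sectionCoord hx)
      (hW.mdifferentiableAt_sectionCoord hx)]
  · rfl
  · exact (H.contDiffAt_anchorCoord hc hx).differentiableAt (by simp)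
  · exact (hV.contDiffAt_comp_extChartAt_symm hc hx).differentiableAt (by simp)
  · exact (hW.contDiffAt_comp_extChartAt_symm hc hx).differentiableAt (by simp)
  · exact H.anchorCoord_structureCoord hx

end Identities

/-! ### Construction of the smooth Lie algebroid and its sheaf. -/

section Existence

variable {E : Type*} [NormedAddCommGroup E] [NormedSpace ℂ E]
  {X : Type*} [TopologicalSpace X] [ChartedSpace E X] [IsManifold 𝓘(ℂ, E) ω X]
  {F : Type*} [NormedAddCommGroup F] [NormedSpace ℂ F] [FiniteDimensional ℂ F]
  {A : X → Type*} [TopologicalSpace (TotalSpace F A)] [∀ x, TopologicalSpace (A x)]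
  [FiberBundle F A] [∀ x, AddCommGroup (A x)] [∀ x, Module ℂ (A x)] [VectorBundle ℂ F A]
  [ContMDiffVectorBundle ω F A 𝓘(ℂ, E)] {V W Z : ∀ y, A y} {x : X}

theorem isSmoothNear_extendSection {U : Opens X} (V : SectionsOn ℝ E ∞ F A U) {x : X} (hx : x ∈ U) :
    IsSmoothNear E F (extendSection V.1) x := by
  filter_upwards [U.isOpen.mem_nhds hx] with y hy
  exact isSectionOn_iff_extendSection.1 V.2 y hy

theorem ContMDiffSection.isSmoothNear (V : Cₛ^∞⟮𝓘(ℝ, E); F, A⟯) (x : X) :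
    IsSmoothNear E F V x :=
  Filter.Eventually.of_forall fun y => V.contMDiff y

variable (H : HolomorphicLieAlgebroid E F A)

theorem HolomorphicLieAlgebroid.smoothBracket_add_left (hV : IsSmoothNear E F V x)
    (hW : IsSmoothNear E F W x) :
    H.smoothBracket (fun y => V y + W y) Z x = H.smoothBracket V Z x + H.smoothBracket W Z x := by
  rw [H.smoothBracket_swap, H.smoothBracket_add_right hV hW, H.smoothBracket_swap Z V,
    H.smoothBracket_swap Z W]
  abel

theorem HolomorphicLieAlgebroid.smoothBracket_const_smul_right (c : ℝ) (hW : IsSmoothNear E F W x) :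
    H.smoothBracket V (fun y => c • W y) x = c • H.smoothBracket V W x := by
  rw [H.smoothBracket_smul_right (f := fun _ => c) mdifferentiableAt_const hW]
  have : modelDeriv (E := E) ℝ (fun _ : X => c) x = 0 := mfderiv_const
  rw [this]
  simp

theorem HolomorphicLieAlgebroid.smoothBracket_const_smul_left (c : ℝ) (hV : IsSmoothNear E F V x) :
    H.smoothBracket (fun y => c • V y) W x = c • H.smoothBracket V W x := by
  rw [H.smoothBracket_swap, H.smoothBracket_const_smul_right c hV, H.smoothBracket_swap W V,
    smul_neg, neg_neg]

theorem HolomorphicLieAlgebroid.smoothBracket_extendSection {U : Opens X}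
    (V W : SectionsOn ℝ E ∞ F A U) :
    IsSectionOn ℝ E ∞ F A U
      (fun x => H.smoothBracket (extendSection V.1) (extendSection W.1) x) :=
  isSectionOn_restrict_iff.2 fun _ hx => H.contMDiffAt_smoothBracket
    (isSmoothNear_extendSection V hx) (isSmoothNear_extendSection W hx)

/-- The bracket of two smooth sections over an open subset. -/
def HolomorphicLieAlgebroid.smoothLie {U : Opens X} (V W : SectionsOn ℝ E ∞ F A U) :
    SectionsOn ℝ E ∞ F A U :=
  ⟨_, H.smoothBracket_extendSection V W⟩

theorem HolomorphicLieAlgebroid.extendSection_smoothLie {U : Opens X} (V W : SectionsOn ℝ E ∞ F A U)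
    {x : X} (hx : x ∈ U) : ∀ᶠ y in nhds x, extendSection (H.smoothLie V W).1 y =
      H.smoothBracket (extendSection V.1) (extendSection W.1) y := by
  filter_upwards [U.isOpen.mem_nhds hx] with y hy
  exact extendSection_apply _ (⟨y, hy⟩ : U)

theorem HolomorphicLieAlgebroid.smoothLie_add {U : Opens X} (V W Z : SectionsOn ℝ E ∞ F A U) :
    H.smoothLie V (W + Z) = H.smoothLie V W + H.smoothLie V Z := by
  ext x
  refine Eq.trans ?_ (H.smoothBracket_add_right (isSmoothNear_extendSection W x.2)
    (isSmoothNear_extendSection Z x.2))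
  exact H.smoothBracket_congr (Filter.Eventually.of_forall fun _ => rfl)
    (Filter.Eventually.of_forall fun y => extendSection_add W.1 Z.1 y)

theorem HolomorphicLieAlgebroid.smoothLie_smul {U : Opens X} (c : ℝ)
    (V W : SectionsOn ℝ E ∞ F A U) : H.smoothLie V (c • W) = c • H.smoothLie V W := by
  ext x
  refine Eq.trans ?_ (H.smoothBracket_const_smul_right c (isSmoothNear_extendSection W x.2))
  exact H.smoothBracket_congr (Filter.Eventually.of_forall fun _ => rfl)
    (Filter.Eventually.of_forall fun y => extendSection_smul c W.1 y)

theorem HolomorphicLieAlgebroid.smoothLie_swap {U : Opens X} (V W : SectionsOn ℝ E ∞ F A U) :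
    H.smoothLie V W = -H.smoothLie W V := by
  ext x
  exact H.smoothBracket_swap _ _ _

/-- The structure of sheaf of real Lie algebras on the sheaf of smooth sections. -/
def HolomorphicLieAlgebroid.smoothSheaf [CompleteSpace E] : SheafLieStructure ℝ E ∞ F A where
  lie U := LinearMap.mk₂ ℝ H.smoothLie
    (fun V W Z => by
      rw [H.smoothLie_swap, H.smoothLie_add, H.smoothLie_swap V, H.smoothLie_swap W, neg_add])
    (fun c V W => by rw [H.smoothLie_swap, H.smoothLie_smul, H.smoothLie_swap V, smul_neg])
    H.smoothLie_add (fun c V W => H.smoothLie_smul c V W)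
  lie_self U V := by
    ext x
    exact H.smoothBracket_self _ _
  jacobi U V W Z := by
    ext x
    have hV := isSmoothNear_extendSection V x.2
    have hW := isSmoothNear_extendSection W x.2
    have hZ := isSmoothNear_extendSection Z x.2
    refine Eq.trans ?_ (H.smoothBracket_jacobi hV hW hZ)
    -- The extension of a bracket and the bracket of the extensions are compared only on `U`. This
    -- suffices because the outer bracket depends on germs alone.
    have h : ∀ V W Z : SectionsOn ℝ E ∞ F A U, (H.smoothLie V (H.smoothLie W Z)).1 x =
        H.smoothBracket (extendSection V.1)
          (H.smoothBracket (extendSection W.1) (extendSection Z.1)) x := fun V W Z =>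
      H.smoothBracket_congr (Filter.Eventually.of_forall fun _ => rfl)
        (H.extendSection_smoothLie W Z x.2)
    rw [← h, ← h, ← h]
    rfl
  lie_res U U' h V W := by
    ext x
    have hr : ∀ V : SectionsOn ℝ E ∞ F A U, ∀ᶠ y in nhds (x : X),
        extendSection (SectionsOn.res h V).1 y = extendSection V.1 y := fun V => by
      filter_upwards [U'.isOpen.mem_nhds x.2] with y hy
      exact extendSection_inclusion h V.1 hy
    exact H.smoothBracket_congr (hr V) (hr W)

/-- The bracket of two global smooth sections. -/
def HolomorphicLieAlgebroid.globalLie (V W : Cₛ^∞⟮𝓘(ℝ, E); F, A⟯) : Cₛ^∞⟮𝓘(ℝ, E); F, A⟯ :=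
  ⟨H.smoothBracket V W, fun x => H.contMDiffAt_smoothBracket (V.isSmoothNear x) (W.isSmoothNear x)⟩

/-- The real smooth Lie algebroid underlying a holomorphic Lie algebroid. -/
def HolomorphicLieAlgebroid.toSmooth [CompleteSpace E] : SmoothLieAlgebroid E F A where
  anchor := H.anchor.forgetComplex
  lie := LinearMap.mk₂ ℝ H.globalLie
    (fun V W Z => by
      ext x
      exact H.smoothBracket_add_left (V.isSmoothNear x) (W.isSmoothNear x))
    (fun c V W => by
      ext x
      exact H.smoothBracket_const_smul_left c (V.isSmoothNear x))
    (fun V W Z => by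
      ext x
      exact H.smoothBracket_add_right (W.isSmoothNear x) (Z.isSmoothNear x))
    (fun c V W => by
      ext x
      exact H.smoothBracket_const_smul_right c (W.isSmoothNear x))
  lie_self V := by
    ext x
    exact H.smoothBracket_self _ _
  jacobi V W Z := by
    ext x
    exact H.smoothBracket_jacobi (V.isSmoothNear x) (W.isSmoothNear x) (Z.isSmoothNear x)
  anchor_lie V W x := H.anchor_smoothBracket (V.isSmoothNear x) (W.isSmoothNear x)
  leibniz f V W x := H.smoothBracket_smul_right
    (f.contMDiff.contMDiffAt.mdifferentiableAt (by simp)) (W.isSmoothNear x)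

theorem HolomorphicLieAlgebroid.toSmooth_induces [CompleteSpace E] :
    H.toSmooth.Induces H.smoothSheaf := by
  intro U V W
  ext x
  have h : ∀ V : Cₛ^∞⟮𝓘(ℝ, E); F, A⟯, ∀ᶠ y in nhds (x : X),
      extendSection (SectionsOn.ofGlobal U V).1 y = V y := fun V => by
    filter_upwards [U.isOpen.mem_nhds x.2] with y hy
    exact extendSection_apply _ (⟨y, hy⟩ : U)
  exact H.smoothBracket_congr (h V) (h W)

theorem HolomorphicLieAlgebroid.smoothSheaf_lie_holomorphicToSmooth [CompleteSpace E]
    (U : Opens X) (V W : SectionsOn ℂ E ω F A U) :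
    H.smoothSheaf.lie U (holomorphicToSmooth E F A U V) (holomorphicToSmooth E F A U W) =
      holomorphicToSmooth E F A U (H.bracket.lie U V W) := by
  ext x
  exact (H.lie_eq_smoothBracket V W x).symm

end Existence

/-! ### Locality, and determination of a bracket by a frame. -/

section Uniqueness

variable {E : Type*} [NormedAddCommGroup E] [NormedSpace ℝ E]
  {X : Type*} [TopologicalSpace X] [ChartedSpace E X] [IsManifold 𝓘(ℝ, E) ∞ X]
  {F : Type*} [NormedAddCommGroup F] [NormedSpace ℝ F]
  {A : X → Type*} [TopologicalSpace (TotalSpace F A)] [∀ x, TopologicalSpace (A x)]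
  [FiberBundle F A] [∀ x, AddCommGroup (A x)] [∀ x, Module ℝ (A x)] [VectorBundle ℝ F A]
  [ContMDiffVectorBundle ∞ F A 𝓘(ℝ, E)]

/-- The bracket of a Lie algebroid inducing a structure of sheaf of Lie algebras is local. -/
theorem SmoothLieAlgebroid.Induces.lie_congr {L : SmoothLieAlgebroid E F A}
    {S : SheafLieStructure ℝ E ∞ F A} (hS : L.Induces S) {V W W' : Cₛ^∞⟮𝓘(ℝ, E); F, A⟯} {x : X}
    (h : ∀ᶠ y in nhds x, W y = W' y) : L.lie V W x = L.lie V W' x := by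
  obtain ⟨s, hs, hso, hx⟩ := eventually_nhds_iff.1 h
  have hW : SectionsOn.ofGlobal ⟨s, hso⟩ W = SectionsOn.ofGlobal ⟨s, hso⟩ W' := by
    ext y
    exact hs y y.2
  have h1 := hS ⟨s, hso⟩ V W
  rw [hW, hS] at h1
  exact (congrArg (fun s => s.1 ⟨x, hx⟩) h1).symm

/-- A smooth multiple of a global section. -/
def ContMDiffSection.fsmul (f : C^∞⟮𝓘(ℝ, E), X; ℝ⟯) (W : Cₛ^∞⟮𝓘(ℝ, E); F, A⟯) :
    Cₛ^∞⟮𝓘(ℝ, E); F, A⟯ :=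
  ⟨fun y => f y • W y, f.contMDiff.smul_section W.contMDiff⟩

theorem ContMDiffSection.finsetSum_apply {ι : Type*} (t : Finset ι) (c : ι → Cₛ^∞⟮𝓘(ℝ, E); F, A⟯)
    (x : X) : (∑ i ∈ t, c i) x = ∑ i ∈ t, c i x := by
  have h := map_sum (ContMDiffSection.coeAddHom 𝓘(ℝ, E) F ∞ A) c t
  exact (congrFun h x).trans (Finset.sum_apply _ _ _)

/-- Two Lie algebroids with the same anchor and local brackets which agree on a frame agree. -/
theorem SmoothLieAlgebroid.lie_eq_of_frame {L L' : SmoothLieAlgebroid E F A}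
    {S S' : SheafLieStructure ℝ E ∞ F A} (hS : L.Induces S) (hS' : L'.Induces S')
    {x : X} (hanchor : ∀ a, L.anchor.toFun x a = L'.anchor.toFun x a)
    {ι : Type*} [Fintype ι] {c : ι → Cₛ^∞⟮𝓘(ℝ, E); F, A⟯}
    (hc : ∀ i j, L.lie (c i) (c j) x = L'.lie (c i) (c j) x)
    (hspan : ∀ W : Cₛ^∞⟮𝓘(ℝ, E); F, A⟯, ∃ g : ι → C^∞⟮𝓘(ℝ, E), X; ℝ⟯,
      ∀ᶠ y in nhds x, W y = (∑ i, (c i).fsmul (g i)) y)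
    (V W : Cₛ^∞⟮𝓘(ℝ, E); F, A⟯) : L.lie V W x = L'.lie V W x := by
  -- The Leibniz rule acts in the second argument only. This is used with a frame section as first
  -- argument, then, after exchanging arguments, with `V` itself.
  have key : ∀ V : Cₛ^∞⟮𝓘(ℝ, E); F, A⟯, (∀ i, L.lie V (c i) x = L'.lie V (c i) x) →
      ∀ W, L.lie V W x = L'.lie V W x := by
    intro V hV W
    obtain ⟨g, hg⟩ := hspan W
    rw [hS.lie_congr hg, hS'.lie_congr hg, map_sum, map_sum]
    rw [ContMDiffSection.finsetSum_apply, ContMDiffSection.finsetSum_apply]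
    refine Finset.sum_congr rfl fun i _ => ?_
    have h1 := L.leibniz (g i) V (c i) x
    have h2 := L'.leibniz (g i) V (c i) x
    rw [hV, hanchor] at h1
    exact h1.trans h2.symm
  have hswap : ∀ (L : SmoothLieAlgebroid E F A) (V W), L.lie V W x = -L.lie W V x := fun L V W => by
    rw [← LinearMap.IsAlt.neg (B := L.lie) L.lie_self W V]
    rfl
  refine key V (fun i => ?_) W
  rw [hswap L, hswap L', key (c i) (hc i) V]

theorem SmoothLieAlgebroid.ext {L L' : SmoothLieAlgebroid E F A}
    (h : ∀ x a, L.anchor.toFun x a = L'.anchor.toFun x a)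
    (h' : ∀ V W x, L.lie V W x = L'.lie V W x) : L = L' := by
  obtain ⟨⟨ρ, hρ⟩, l, _, _, _, _⟩ := L
  obtain ⟨⟨ρ', hρ'⟩, l', _, _, _, _⟩ := L'
  obtain rfl : ρ = ρ' := by
    funext x
    exact ContinuousLinearMap.ext (h x)
  obtain rfl : l = l' := by
    ext V W x
    exact h' V W x
  rfl

end Uniqueness

/-! ### Global frames from bump functions, and uniqueness. -/

section Frame

variable {E : Type*} [NormedAddCommGroup E] [NormedSpace ℂ E] [FiniteDimensional ℂ E]
  {X : Type*} [TopologicalSpace X] [T2Space X] [ChartedSpace E X] [IsManifold 𝓘(ℂ, E) ω X]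
  {F : Type*} [NormedAddCommGroup F] [NormedSpace ℂ F] [FiniteDimensional ℂ F]
  {A : X → Type*} [TopologicalSpace (TotalSpace F A)] [∀ x, TopologicalSpace (A x)]
  [FiberBundle F A] [∀ x, AddCommGroup (A x)] [∀ x, Module ℂ (A x)] [VectorBundle ℂ F A]
  [ContMDiffVectorBundle ω F A 𝓘(ℂ, E)]
  {e : Trivialization F (π F A)} [MemTrivializationAtlas e]

/-- Near a point of the domain of a trivialization, constant sections extend to global smooth
sections, and smooth sections are combinations of these with smooth coefficients. -/
theorem exists_global_frame {ι : Type*} [Fintype ι] (b : Module.Basis ι ℝ F) {x : X}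
    (hx : x ∈ e.baseSet) :
    ∃ c : ι → Cₛ^∞⟮𝓘(ℝ, E); F, A⟯,
      (∀ᶠ y in nhds x, ∀ i, c i y = e.symmL ℂ y (b i)) ∧
      ∀ W : Cₛ^∞⟮𝓘(ℝ, E); F, A⟯, ∃ g : ι → C^∞⟮𝓘(ℝ, E), X; ℝ⟯,
        ∀ᶠ y in nhds x, W y = (∑ i, (c i).fsmul (g i)) y := by
  -- Only a bump function with closed support in the base set is wanted, so the basis is queried
  -- with the trivial neighbourhood.
  obtain ⟨χ, hχ, -⟩ := (SmoothBumpFunction.nhds_basis_support (I := 𝓘(ℝ, E))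
    (e.open_baseSet.mem_nhds hx)).mem_iff.1 (Filter.univ_mem (f := nhds x))
  have hc : ∀ u : F, ContMDiff 𝓘(ℝ, E) (𝓘(ℝ, E).prod 𝓘(ℝ, F)) ∞
      (fun y => TotalSpace.mk' F y (((χ : X → ℝ) • fun y => e.symmL ℂ y u : ∀ y, A y) y)) :=
    fun u => ContMDiffOn.smul_section_of_tsupport χ.contMDiff.contMDiffOn e.open_baseSet hχ
      fun y hy => (contMDiffAt_constSection_real u hy).contMDiffWithinAt
  let c : ι → Cₛ^∞⟮𝓘(ℝ, E); F, A⟯ := fun i => ⟨_, hc (b i)⟩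
  have hcx : ∀ᶠ y in nhds x, ∀ i, c i y = e.symmL ℂ y (b i) := by
    filter_upwards [χ.eventuallyEq_one] with y hy i
    change χ y • e.symmL ℂ y (b i) = _
    rw [hy, Pi.one_apply, one_smul]
  refine ⟨c, hcx, fun W => ?_⟩
  -- The coefficients are cut off as well, to be globally smooth. Where the bump function equals one
  -- neither cutoff is felt.
  have hg : ∀ i, ContMDiff 𝓘(ℝ, E) 𝓘(ℝ, ℝ) ∞
      (fun y => χ y • b.coord i (sectionCoord e W y)) := fun i => by
    refine contMDiff_of_tsupport fun y hy => ?_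
    have hy' : y ∈ e.baseSet := hχ (tsupport_smul_subset_left _ _ hy)
    have h := (contMDiffAt_sectionCoord_iff e hy').2 (W.contMDiff y)
    exact χ.contMDiff.contMDiffAt.smul
      ((LinearMap.toContinuousLinearMap (b.coord i)).contMDiff.contMDiffAt.comp y h)
  refine ⟨fun i => ⟨_, hg i⟩, ?_⟩
  filter_upwards [hcx, χ.eventuallyEq_one, e.open_baseSet.mem_nhds hx] with y hy hy1 hye
  rw [ContMDiffSection.finsetSum_apply]
  have h : ∀ i, (c i).fsmul ⟨_, hg i⟩ y = e.symmL ℂ y (b.coord i (sectionCoord e W y) • b i) :=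
    fun i => by
      change (χ y • b.coord i (sectionCoord e W y)) • c i y = _
      rw [hy, hy1, Pi.one_apply, one_smul, ← Complex.coe_smul, ← map_smul, Complex.coe_smul]
  simp_rw [h]
  rw [← map_sum]
  simp only [Module.Basis.coord_apply, b.sum_repr]
  exact (symmL_sectionCoord e W hye).symm

/-- A real Lie algebroid extending a holomorphic one is determined by its anchor. -/
theorem HolomorphicLieAlgebroid.lie_eq_lie (H : HolomorphicLieAlgebroid E F A)
    {L L' : SmoothLieAlgebroid E F A} {S S' : SheafLieStructure ℝ E ∞ F A}
    (hS : L.Induces S) (hS' : L'.Induces S')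
    (hanchor : ∀ x a, L.anchor.toFun x a = L'.anchor.toFun x a)
    (hH : ∀ (U : Opens X) (V W : SectionsOn ℂ E ω F A U),
      S.lie U (holomorphicToSmooth E F A U V) (holomorphicToSmooth E F A U W) =
        holomorphicToSmooth E F A U (H.bracket.lie U V W))
    (hH' : ∀ (U : Opens X) (V W : SectionsOn ℂ E ω F A U),
      S'.lie U (holomorphicToSmooth E F A U V) (holomorphicToSmooth E F A U W) =
        holomorphicToSmooth E F A U (H.bracket.lie U V W))
    (V W : Cₛ^∞⟮𝓘(ℝ, E); F, A⟯) (x : X) : L.lie V W x = L'.lie V W x := by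
  let e := trivializationAt F A x
  -- The smooth Leibniz rule has real coefficients, so a real basis is needed. Its vectors still
  -- give holomorphic constant sections, whose brackets are prescribed.
  let b := Module.finBasis ℝ F
  obtain ⟨c, hc, hspan⟩ := exists_global_frame (E := E) (A := A) b (mem_baseSet_trivializationAt F A x)
  refine SmoothLieAlgebroid.lie_eq_of_frame hS hS' (hanchor x) (fun i j => ?_) hspan V W
  obtain ⟨s, hs, hso, hxs⟩ := eventually_nhds_iff.1 hc
  let U : Opens X := ⟨s, hso⟩ ⊓ e.opens
  have hxU : x ∈ U := ⟨hxs, mem_baseSet_trivializationAt F A x⟩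
  have hcU : ∀ i, SectionsOn.ofGlobal U (c i) = holomorphicToSmooth E F A U
      (SectionsOn.res inf_le_right (constSection (E := E) e (b i))) := fun i => by
    ext y
    exact hs y y.2.1 i
  have h := hS U (c i) (c j)
  have h' := hS' U (c i) (c j)
  rw [hcU, hcU, hH] at h
  rw [hcU, hcU, hH'] at h'
  exact congrArg (fun s => s.1 ⟨x, hxU⟩) (h.symm.trans h')

end Frame

/-! ### Existence and uniqueness combined. -/

theorem mainTheorem7
    {E : Type*} [NormedAddCommGroup E] [NormedSpace ℂ E] [FiniteDimensional ℂ E]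
    {X : Type*} [TopologicalSpace X] [T2Space X] [ChartedSpace E X] [IsManifold 𝓘(ℂ, E) ω X]
    {F : Type*} [NormedAddCommGroup F] [NormedSpace ℂ F] [FiniteDimensional ℂ F]
    {A : X → Type*} [TopologicalSpace (TotalSpace F A)] [∀ x, TopologicalSpace (A x)]
    [FiberBundle F A] [∀ x, AddCommGroup (A x)] [∀ x, Module ℂ (A x)] [VectorBundle ℂ F A]
    [ContMDiffVectorBundle ω F A 𝓘(ℂ, E)]
    (H : HolomorphicLieAlgebroid E F A) :
    ∃! L : SmoothLieAlgebroid E F A,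
      (∀ (x : X) (a : A x), L.anchor.toFun x a = toRealTangent E x (H.anchor.toFun x a)) ∧
      ∃ S : SheafLieStructure ℝ E ∞ F A, L.Induces S ∧
        ∀ (U : Opens X) (V W : SectionsOn ℂ E ω F A U),
          S.lie U (holomorphicToSmooth E F A U V) (holomorphicToSmooth E F A U W) =
            holomorphicToSmooth E F A U (H.bracket.lie U V W) := by
  -- Completeness is what pulling back Lie brackets of vector fields to open submanifolds requires.
  have : CompleteSpace E := FiniteDimensional.complete ℂ E
  refine ⟨H.toSmooth, ⟨fun _ _ => rfl, H.smoothSheaf, H.toSmooth_induces,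
    H.smoothSheaf_lie_holomorphicToSmooth⟩, ?_⟩
  rintro L ⟨hanchor, S, hS, hH⟩
  exact SmoothLieAlgebroid.ext hanchor fun V W x =>
    H.lie_eq_lie hS H.toSmooth_induces hanchor hH H.smoothSheaf_lie_holomorphicToSmooth V W x
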